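/- Fix an integer $n\ge 0$. A Ferrers diagram is a left-justified array of cells with weakly decreasing row lengths from top to bottom; empty rows are allowed (rows of length $0$ at the bottom are counted as rows). A permutation tableau is a filling of a Ferrers diagram with $0$'s and $1$'s such that each column contains at least one $1$ and no $0$ has both a $1$ above it in the same column and a $1$ to the left of it in the same row. Its length is its number of rows (including empty rows) plus its number of columns, and $\mathrm{PT}_n$ is the set of permutation tableaux of length $n$. For $T\in\mathrm{PT}_n$, let $\mathrm{urr}(T)$ be the number of unrestricted rows, i.e. rows (including empty ones) containing no $0$ that has a $1$ above it in the same column, and let $\mathrm{urc}(T)$ be the number of unrestricted columns, i.e. columns containing no $0$ that has a $1$ to the left of it in the same row. For a permutation $\pi=\pi_1\cdots\pi_n\in\mathfrak S_n$, let $\mathrm{RLmin}(\pi)$ be the number of right-to-left minima (entries $\pi_i$ with $\pi_i<\pi_j$ for all $j>i$), let $\mathrm{LRmax}(\pi)$ be the number of left-to-right maxima (entries $\pi_i$ with $\pi_i>\pi_j$ for all $j<i$), and let $\mathrm{pivot}(\pi)$ be the number of entries that are both. Then $$\sum_{T\in \mathrm{PT}_n} X^{\mathrm{urr}(T)}\,Y^{\mathrm{urc}(T)}=\sum_{\pi\in\mathfrak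 S_n}X^{\mathrm{RLmin}(\pi)}\,Y^{\mathrm{LRmax}(\pi)-\mathrm{pivot}(\pi)},$$ as an identity of polynomials in $X$ and $Y$; equivalently, it holds for any elements $X,Y$ of any commutative semiring (with the convention $0^0=1$). -/

import Mathlib

/-- A permutation tableau of length `n`: a filling with 0's and 1's of a Ferrers diagram which may
have empty rows.  In the coordinates of `YoungDiagram` (English notation) the cell `(i, j)` lies in
row `i` and column `j`, rows are numbered from top to bottom and columns from left to right, from 0.
A Ferrers diagram with empty rows is a Young diagram `shape` with a number `numRows` of rows which
is at least the number of nonempty rows; its number of columns is `shape.rowLen 0`. The filling is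
given by the set `ones` of the cells that hold a 1; all the other cells hold a 0. -/
@[ext]
structure PermutationTableau (n : ℕ) where
  /-- the nonempty rows of the Ferrers diagram -/
  shape : YoungDiagram
  /-- the number of rows, empty ones included -/
  numRows : ℕ
  /-- the cells filled with a 1 -/
  ones : Finset (ℕ × ℕ)
  colLen_le : shape.colLen 0 ≤ numRows
  /-- the length is the number of rows plus the number of columns -/
  length_eq : numRows + shape.rowLen 0 = n
  ones_subset : ones ⊆ shape.cells
  /-- each column contains at least one 1 -/
  exists_one : ∀ j < shape.rowLen 0, ∃ i < numRows, (i, j) ∈ ones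
  /-- no 0 has both a 1 above it in its column and a 1 to the left of it in its row -/
  zero_cond : ∀ i j, (i, j) ∈ shape.cells → (i, j) ∉ ones →
    ¬ ((∃ i' < i, (i', j) ∈ ones) ∧ (∃ j' < j, (i, j') ∈ ones))

namespace PermutationTableau

variable {n : ℕ}

/-- The number of columns. -/
def numCols (T : PermutationTableau n) : ℕ := T.shape.rowLen 0

/-- The cell `(i, j)` holds a restricted 0: a 0 with a 1 above it in the same column. -/
def IsRestrictedZero (T : PermutationTableau n) (i j : ℕ) : Prop :=
  (i, j) ∈ T.shape.cells ∧ (i, j) ∉ T.ones ∧ ∃ i' < i, (i', j) ∈ T.ones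

/-- The cell `(i, j)` holds a c-restricted 0: a 0 with a 1 to the left of it in the same row. -/
def IsCRestrictedZero (T : PermutationTableau n) (i j : ℕ) : Prop :=
  (i, j) ∈ T.shape.cells ∧ (i, j) ∉ T.ones ∧ ∃ j' < j, (i, j') ∈ T.ones

instance (T : PermutationTableau n) (i j : ℕ) : Decidable (T.IsRestrictedZero i j) :=
  inferInstanceAs (Decidable (_ ∧ _))

instance (T : PermutationTableau n) (i j : ℕ) : Decidable (T.IsCRestrictedZero i j) :=
  inferInstanceAs (Decidable (_ ∧ _))

/-- The number of unrestricted rows (those without a restricted 0). -/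
def urr (T : PermutationTableau n) : ℕ :=
  ((Finset.range T.numRows).filter fun i => ∀ j < T.numCols, ¬ T.IsRestrictedZero i j).card

/-- The number of unrestricted columns (those without a c-restricted 0). -/
def urc (T : PermutationTableau n) : ℕ :=
  ((Finset.range T.numCols).filter fun j => ∀ i < T.numRows, ¬ T.IsCRestrictedZero i j).card

/-- All cells lie in the box of `numRows` rows and `numCols` columns. -/
theorem mem_box (T : PermutationTableau n) {i j : ℕ} (h : (i, j) ∈ T.shape.cells) :
    i < T.numRows ∧ j < T.numCols := by
  rw [YoungDiagram.mem_cells] at h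
  constructor
  · have h1 : (i, 0) ∈ T.shape := T.shape.up_left_mem le_rfl (Nat.zero_le j) h
    exact lt_of_lt_of_le (YoungDiagram.mem_iff_lt_colLen.1 h1) T.colLen_le
  · have h1 : (0, j) ∈ T.shape := T.shape.up_left_mem (Nat.zero_le i) le_rfl h
    exact YoungDiagram.mem_iff_lt_rowLen.1 h1

theorem cells_subset (T : PermutationTableau n) :
    T.shape.cells ⊆ Finset.range n ×ˢ Finset.range n := by
  rintro ⟨i, j⟩ h
  have h1 := T.mem_box h
  have h2 := T.length_eq
  unfold numCols at h1
  simp only [Finset.mem_product, Finset.mem_range]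
  omega

/-- There are finitely many permutation tableaux of length `n`. -/
instance : Finite (PermutationTableau n) := by
  let B := Finset.range n ×ˢ Finset.range n
  let f : PermutationTableau n → B.powerset × Fin (n + 1) × B.powerset := fun T =>
    (⟨T.shape.cells, Finset.mem_powerset.2 T.cells_subset⟩,
      ⟨T.numRows, by have := T.length_eq; omega⟩,
      ⟨T.ones, Finset.mem_powerset.2 (T.ones_subset.trans T.cells_subset)⟩)
  refine Finite.of_injective f fun S T h => ?_
  simp only [f, Prod.mk.injEq, Subtype.mk.injEq, Fin.mk.injEq] at h
  exact PermutationTableau.ext (YoungDiagram.ext h.1) h.2.1 h.2.2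

noncomputable instance : Fintype (PermutationTableau n) := Fintype.ofFinite _

end PermutationTableau

namespace PermStat

variable {n : ℕ}

/-- The set of right-to-left minima of the word `π 0, π 1, …, π (n - 1)`. -/
def RLMIN (π : Equiv.Perm (Fin n)) : Finset (Fin n) :=
  (Finset.univ.filter fun i => ∀ j, i < j → π i < π j).image π

/-- The set of left-to-right maxima of the word `π 0, π 1, …, π (n - 1)`. -/
def LRMAX (π : Equiv.Perm (Fin n)) : Finset (Fin n) :=
  (Finset.univ.filter fun i => ∀ j, j < i → π j < π i).image π

/-- The number of right-to-left minima. -/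
def RLmin (π : Equiv.Perm (Fin n)) : ℕ := (RLMIN π).card

/-- The number of left-to-right maxima. -/
def LRmax (π : Equiv.Perm (Fin n)) : ℕ := (LRMAX π).card

/-- The number of pivots: entries that are both a left-to-right maximum and a right-to-left
minimum. -/
def pivot (π : Equiv.Perm (Fin n)) : ℕ := (LRMAX π ∩ RLMIN π).card

/-- So the subtraction of natural numbers in `LRmax π - pivot π` is a true difference. -/
theorem pivot_le_LRmax (π : Equiv.Perm (Fin n)) : pivot π ≤ LRmax π :=
  Finset.card_le_card Finset.inter_subset_left

end PermStat

/-! Write `D = southOp x`, `E = westOp x y` and `δ₀ = Pi.single 0 1`. Both sides of the identity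
equal the vacuum expectation `((D + E) ^ n) δ₀ 0`.

Permutations: build the graph of a permutation by adding value `m` and then position `m`, for each
`m`, and let `k` be the number of positions (equally, of values) still open. A choice among open
slots has weight 1, except that the least open slot has weight `x` (for a nonexcedance) or `y` (for
an excedance). These exceptional choices are exactly the right-to-left minima and the left-to-right
maxima that are not pivots (`prod_entryWeight_permGraph`). `D` covers the case where the new value
stays open until its own position is added, `E` the case where it goes to an earlier position
(`partialSum_succ_succ`).

Tableaux: read the border of the diagram from north-east to south-west as a word, `D` for a row and
`E` for a column. The fillings of one diagram have the generating function `(word δ₀) 0`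
(`pathSum_eq`). Indeed, a south-east corner is a factor `DE`, and according to the content of the
corner the generating function satisfies a four-term recursion (`IsOuterCorner.fillingSum_eq`). This
is the commutation rule `southOp_westOp`: `DE = ED + E + D` plus `y - 1` times a rank-one operator,
which cuts the diagram into two independent ones. Words without a corner are settled by `(E h) 0 =
0` and `D δ₀ = x δ₀`. Summing over all words expands `(D + E) ^ n`. -/

/-! ### The two transfer operators and their commutation rule. -/

section Transfer

variable {R : Type*} [CommRing R]

/-- The total weight `z + 1 + ⋯ + 1` of `k` choices, the first of which has weight `z`. -/
def choiceWeight (z : R) : ℕ → R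
  | 0 => 0
  | k + 1 => z + k

/-- The operator of a south step of the border path. -/
def southOp (x : R) : Module.End R (ℕ → R) where
  toFun h k := choiceWeight x (k + 1) * h k + h (k + 1)
  map_add' f g := by ext k; simp only [Pi.add_apply]; ring
  map_smul' r f := by ext k; simp only [Pi.smul_apply, smul_eq_mul, RingHom.id_apply]; ring

/-- The operator of a west step of the border path. -/
def westOp (x y : R) : Module.End R (ℕ → R) where
  toFun h k := choiceWeight y k * (h k + choiceWeight x k * h (k - 1))
  map_add' f g := by ext k; simp only [Pi.add_apply]; ring
  map_smul' r f := by ext k; simp only [Pi.smul_apply, smul_eq_mul, RingHom.id_apply]; ring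

theorem southOp_apply (x : R) (h : ℕ → R) (k : ℕ) :
    southOp x h k = choiceWeight x (k + 1) * h k + h (k + 1) := rfl

theorem westOp_apply (x y : R) (h : ℕ → R) (k : ℕ) :
    westOp x y h k = choiceWeight y k * (h k + choiceWeight x k * h (k - 1)) := rfl

theorem southOp_single (x : R) : southOp x (Pi.single 0 1) = x • Pi.single 0 1 := by
  ext k
  rcases k with _ | k <;> simp [southOp_apply, choiceWeight]

theorem westOp_apply_zero (x y : R) (h : ℕ → R) : westOp x y h 0 = 0 := by
  simp [westOp_apply, choiceWeight]

/-- `choiceWeight y` grows by 1 at each step, except from 0 to 1, where it grows by `y`. Hence the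
defect `y - 1`, supported at `k = 0`. -/
theorem southOp_westOp (x y : R) (h : ℕ → R) :
    southOp x (westOp x y h) = westOp x y (southOp x h) + westOp x y h + southOp x h +
      ((y - 1) * southOp x h 0) • Pi.single 0 1 := by
  ext k
  rcases k with _ | _ | k <;>
    simp [southOp_apply, westOp_apply, choiceWeight] <;> ring

end Transfer

/-! ### Partial permutations, grown by one value or one position at a time. -/

section PartialInjections

/-- The graphs of the injections from subsets of `{0, …, a - 1}` to `{0, …, b - 1}`. -/
def partialInjections (a b : ℕ) : Finset (Finset (ℕ × ℕ)) :=
  (Finset.range a ×ˢ Finset.range b).powerset.filter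
    fun S => ∀ p ∈ S, ∀ q ∈ S, p.1 = q.1 ↔ p.2 = q.2

theorem mem_partialInjections {a b : ℕ} {S : Finset (ℕ × ℕ)} :
    S ∈ partialInjections a b ↔ (∀ p q, (p, q) ∈ S → p < a ∧ q < b) ∧
      ∀ p q p' q', (p, q) ∈ S → (p', q') ∈ S → (p = p' ↔ q = q') := by
  simp only [partialInjections, Finset.mem_filter, Finset.mem_powerset, Finset.subset_iff,
    Prod.forall, Finset.mem_product, Finset.mem_range]
  constructor
  · rintro ⟨h, h'⟩
    exact ⟨h, fun p q p' q' h1 h2 => h' p q h1 p' q' h2⟩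
  · rintro ⟨h, h'⟩
    exact ⟨h, fun p q h1 p' q' h2 => h' p q p' q' h1 h2⟩

/-- The positions without a value. -/
def openPositions (a : ℕ) (S : Finset (ℕ × ℕ)) : Finset ℕ :=
  Finset.range a \ S.image Prod.fst

/-- The values without a position. -/
def openValues (b : ℕ) (S : Finset (ℕ × ℕ)) : Finset ℕ :=
  Finset.range b \ S.image Prod.snd

theorem mem_openPositions {a p : ℕ} {S : Finset (ℕ × ℕ)} :
    p ∈ openPositions a S ↔ p < a ∧ ∀ q, (p, q) ∉ S := by
  simp [openPositions]

theorem mem_openValues {b q : ℕ} {S : Finset (ℕ × ℕ)} :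
    q ∈ openValues b S ↔ q < b ∧ ∀ p, (p, q) ∉ S := by
  simp [openValues]

theorem card_openPositions {a b : ℕ} {S : Finset (ℕ × ℕ)} (hS : S ∈ partialInjections a b) :
    (openPositions a S).card = a - S.card := by
  rw [mem_partialInjections] at hS
  rw [openPositions, Finset.card_sdiff_of_subset, Finset.card_image_of_injOn, Finset.card_range]
  · rintro ⟨p, q⟩ h1 ⟨p', q'⟩ h2 (rfl : p = p')
    simpa using hS.2 p q p q' h1 h2
  · intro p
    simp only [Finset.mem_image, Prod.exists, exists_and_right, exists_eq_right, Finset.mem_range]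
    rintro ⟨q, h⟩
    exact (hS.1 p q h).1

theorem card_openValues {a b : ℕ} {S : Finset (ℕ × ℕ)} (hS : S ∈ partialInjections a b) :
    (openValues b S).card = b - S.card := by
  rw [mem_partialInjections] at hS
  rw [openValues, Finset.card_sdiff_of_subset, Finset.card_image_of_injOn, Finset.card_range]
  · rintro ⟨p, q⟩ h1 ⟨p', q'⟩ h2 (rfl : q = q')
    simpa using hS.2 p q p' q h1 h2
  · intro q
    simp only [Finset.mem_image, Prod.exists, exists_eq_right, Finset.mem_range]
    rintro ⟨p, h⟩
    exact (hS.1 p q h).2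

theorem card_le_of_mem_partialInjections {a b : ℕ} {S : Finset (ℕ × ℕ)}
    (hS : S ∈ partialInjections a b) : S.card ≤ a := by
  rw [mem_partialInjections] at hS
  rw [← Finset.card_range a]
  refine Finset.card_le_card_of_injOn Prod.fst (fun e he => ?_) ?_
  · simpa using (hS.1 e.1 e.2 he).1
  · rintro ⟨p, q⟩ h1 ⟨p', q'⟩ h2 (rfl : p = p')
    simpa using hS.2 p q p q' h1 h2

/-- Either the new value `b` is unused, or deleting its entry frees the position that it occupied.
-/
theorem sum_partialInjections_succ_right {M : Type*} [AddCommMonoid M] (a b : ℕ)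
    (F : Finset (ℕ × ℕ) → M) :
    ∑ S ∈ partialInjections a (b + 1), F S =
      ∑ S ∈ partialInjections a b, (F S + ∑ p ∈ openPositions a S, F (insert (p, b) S)) := by
  classical
  rw [Finset.sum_add_distrib, Finset.sum_sigma',
    ← Finset.sum_filter_add_sum_filter_not _ (fun S => ∀ p, (p, b) ∉ S)]
  congr 1
  · refine Finset.sum_congr ?_ fun _ _ => rfl
    ext S
    simp only [Finset.mem_filter, mem_partialInjections]
    grind
  · symm
    refine Finset.sum_bij (fun s _ => insert (s.2, b) s.1) ?_ ?_ ?_ ?_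
    · rintro ⟨S, p⟩ h
      simp only [Finset.mem_sigma, Finset.mem_filter, mem_partialInjections,
        mem_openPositions] at h ⊢
      grind
    · rintro ⟨S, p⟩ h ⟨S', p'⟩ h' heq
      simp only [Finset.mem_sigma, mem_partialInjections, mem_openPositions] at h h' heq
      have hp : p = p' := by
        have : (p, b) ∈ insert (p', b) S' := heq ▸ Finset.mem_insert_self _ _
        grind
      subst hp
      have hS : S = S' := by
        ext ⟨u, v⟩
        have := Finset.ext_iff.1 heq (u, v)
        grind
      rw [hS]
    · intro S hS
      simp only [Finset.mem_filter, mem_partialInjections, not_forall, not_not] at hS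
      obtain ⟨hS, p, hp⟩ := hS
      refine ⟨⟨S.erase (p, b), p⟩, ?_, Finset.insert_erase hp⟩
      simp only [Finset.mem_sigma, mem_partialInjections, mem_openPositions]
      grind
    · intros; rfl

theorem sum_partialInjections_succ_left {M : Type*} [AddCommMonoid M] (a b : ℕ)
    (F : Finset (ℕ × ℕ) → M) :
    ∑ S ∈ partialInjections (a + 1) b, F S =
      ∑ S ∈ partialInjections a b, (F S + ∑ q ∈ openValues b S, F (insert (a, q) S)) := by
  classical
  rw [Finset.sum_add_distrib, Finset.sum_sigma',
    ← Finset.sum_filter_add_sum_filter_not _ (fun S => ∀ q, (a, q) ∉ S)]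
  congr 1
  · refine Finset.sum_congr ?_ fun _ _ => rfl
    ext S
    simp only [Finset.mem_filter, mem_partialInjections]
    grind
  · symm
    refine Finset.sum_bij (fun s _ => insert (a, s.2) s.1) ?_ ?_ ?_ ?_
    · rintro ⟨S, q⟩ h
      simp only [Finset.mem_sigma, Finset.mem_filter, mem_partialInjections,
        mem_openValues] at h ⊢
      grind
    · rintro ⟨S, q⟩ h ⟨S', q'⟩ h' heq
      simp only [Finset.mem_sigma, mem_partialInjections, mem_openValues] at h h' heq
      have hq : q = q' := by
        have : (a, q) ∈ insert (a, q') S' := heq ▸ Finset.mem_insert_self _ _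
        grind
      subst hq
      have hS : S = S' := by
        ext ⟨u, v⟩
        have := Finset.ext_iff.1 heq (u, v)
        grind
      rw [hS]
    · intro S hS
      simp only [Finset.mem_filter, mem_partialInjections, not_forall, not_not] at hS
      obtain ⟨hS, q, hq⟩ := hS
      refine ⟨⟨S.erase (a, q), q⟩, ?_, Finset.insert_erase hq⟩
      simp only [Finset.mem_sigma, mem_partialInjections, mem_openValues]
      grind
    · intros; rfl

variable {R : Type*} [CommRing R]

open Classical in
/-- The weight of an entry of a partial permutation: `x` for a right-to-left minimum, `y` for a
left-to-right maximum that is not a fixed point. -/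
noncomputable def entryWeight (x y : R) (S : Finset (ℕ × ℕ)) (e : ℕ × ℕ) : R :=
  if e.2 ≤ e.1 then if ∀ w < e.2, ∃ q < e.1, (q, w) ∈ S then x else 1
  else if ∀ q < e.1, ∃ w < e.2, (q, w) ∈ S then y else 1

/-- The generating function of partial permutations, with a factor that depends on the size. -/
noncomputable def partialSum (x y : R) (a b : ℕ) (g : ℕ → R) : R :=
  ∑ S ∈ partialInjections a b, (∏ e ∈ S, entryWeight x y S e) * g S.card

-- Only the least element of `O` has no smaller element in `O`. This turns the choice of an open
-- slot into a `choiceWeight`.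
open Classical in
theorem sum_first (z : R) (O : Finset ℕ) :
    ∑ p ∈ O, (if ∀ q < p, q ∉ O then z else 1) = choiceWeight z O.card := by
  rcases O.eq_empty_or_nonempty with rfl | hO
  · simp [choiceWeight]
  · have hm := O.min'_mem hO
    rw [← Finset.add_sum_erase _ _ hm, if_pos, Finset.sum_congr rfl (g := fun _ => (1 : R))]
    · obtain ⟨k, hk⟩ : ∃ k, O.card = k + 1 := ⟨O.card - 1, by have := hO.card_pos; omega⟩
      simp [choiceWeight, hk, Finset.card_erase_of_mem hm]
    · intro p hp
      refine if_neg fun h => ?_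
      exact h _ (O.min'_lt_of_mem_erase_min' hO hp) hm
    · intro q hq hqO
      exact absurd (O.min'_le q hqO) (not_le.2 hq)

theorem partialSum_succ_right (x y : R) {a b : ℕ} (hab : a ≤ b) (g : ℕ → R) :
    partialSum x y a (b + 1) g =
      partialSum x y a b fun m => g m + choiceWeight y (a - m) * g (m + 1) := by
  classical
  rw [partialSum, partialSum, sum_partialInjections_succ_right]
  refine Finset.sum_congr rfl fun S hS => ?_
  rw [← card_openPositions hS, ← sum_first, mul_add, Finset.sum_mul, Finset.mul_sum]
  congr 1
  refine Finset.sum_congr rfl fun p hp => ?_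
  rw [mem_partialInjections] at hS
  have hpO := hp
  rw [mem_openPositions] at hp
  have hpS : (p, b) ∉ S := hp.2 b
  rw [Finset.card_insert_of_notMem hpS, Finset.prod_insert hpS, mul_comm (entryWeight _ _ _ _),
    mul_assoc]
  congr 1
  -- The weight of an old entry depends only on values below its own, so the new largest value does
  -- not change it.
  · refine Finset.prod_congr rfl fun e he => ?_
    have h2 := (hS.1 e.1 e.2 he).2
    unfold entryWeight
    congr 2 <;> simp only [eq_iff_iff] <;> grind
  · congr 1
    unfold entryWeight
    -- The new entry is a strict excedance, as `p < a ≤ b`.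
    rw [if_neg (by simp only; omega)]
    congr 1
    simp only [eq_iff_iff, mem_openPositions]
    grind

theorem partialSum_succ_left (x y : R) {a b : ℕ} (hab : b ≤ a + 1) (g : ℕ → R) :
    partialSum x y (a + 1) b g =
      partialSum x y a b fun m => g m + choiceWeight x (b - m) * g (m + 1) := by
  classical
  rw [partialSum, partialSum, sum_partialInjections_succ_left]
  refine Finset.sum_congr rfl fun S hS => ?_
  rw [← card_openValues hS, ← sum_first, mul_add, Finset.sum_mul, Finset.mul_sum]
  congr 1
  refine Finset.sum_congr rfl fun q hq => ?_
  rw [mem_partialInjections] at hS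
  rw [mem_openValues] at hq
  have hqS : (a, q) ∉ S := hq.2 a
  rw [Finset.card_insert_of_notMem hqS, Finset.prod_insert hqS, mul_comm (entryWeight _ _ _ _),
    mul_assoc]
  congr 1
  -- The weight of an old entry depends only on positions before its own, so the new last position
  -- does not change it.
  · refine Finset.prod_congr rfl fun e he => ?_
    have h2 := (hS.1 e.1 e.2 he).1
    unfold entryWeight
    congr 2 <;> simp only [eq_iff_iff] <;> grind
  · congr 1
    unfold entryWeight
    -- The new entry is a fixed point or lies below the diagonal, as `q < b ≤ a + 1`.
    rw [if_pos (by simp only; omega)]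
    congr 1
    simp only [eq_iff_iff, mem_openValues]
    grind

/-- Value `n` is added before position `n`, so a fixed point counts as a choice of the new position,
of type `x`. If value `n` stays open, position `n` sees `k + 1` open values, which gives `southOp`;
if it is placed, position `n` sees `k`, which gives `westOp`. -/
theorem partialSum_succ_succ (x y : R) (n : ℕ) (h : ℕ → R) :
    partialSum x y (n + 1) (n + 1) (fun m => h (n + 1 - m)) =
      partialSum x y n n (fun m => (southOp x + westOp x y) h (n - m)) := by
  rw [partialSum_succ_left x y le_rfl, partialSum_succ_right x y le_rfl, partialSum, partialSum]
  refine Finset.sum_congr rfl fun S hS => ?_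
  obtain ⟨k, hk⟩ := Nat.exists_eq_add_of_le (card_le_of_mem_partialInjections hS)
  congr 1
  simp only [LinearMap.add_apply, Pi.add_apply, southOp_apply, westOp_apply]
  rw [show n + 1 - S.card = k + 1 by omega, show n - S.card = k by omega,
    show n + 1 - (S.card + 1) = k by omega, show n + 1 - (S.card + 1 + 1) = k - 1 by omega]
  ring

theorem partialSum_eq (x y : R) (n : ℕ) (h : ℕ → R) :
    partialSum x y n n (fun m => h (n - m)) = ((southOp x + westOp x y) ^ n) h 0 := by
  induction n generalizing h with
  | zero =>
    have : partialInjections 0 0 = {∅} := by ext S; simp [partialInjections]; grind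
    simp [partialSum, this]
  | succ n ih => rw [partialSum_succ_succ, ih, pow_succ]; rfl

end PartialInjections

/-! ### Permutations as complete partial permutations. -/

section Permutations

open Equiv

variable {n : ℕ}

/-- The graph of a permutation. -/
def permGraph (π : Perm (Fin n)) : Finset (ℕ × ℕ) :=
  Finset.univ.image fun i : Fin n => ((i : ℕ), (π i : ℕ))

theorem mem_permGraph {π : Perm (Fin n)} {p q : ℕ} :
    (p, q) ∈ permGraph π ↔ ∃ i : Fin n, (i : ℕ) = p ∧ (π i : ℕ) = q := by
  simp [permGraph]

theorem permGraph_entry_injective (π : Perm (Fin n)) :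
    Function.Injective fun i : Fin n => ((i : ℕ), (π i : ℕ)) := by
  intro i j h
  simp only [Prod.mk.injEq] at h
  exact Fin.ext h.1

theorem card_permGraph (π : Perm (Fin n)) : (permGraph π).card = n := by
  rw [permGraph, Finset.card_image_of_injective _ (permGraph_entry_injective π), Finset.card_fin]

theorem permGraph_injective : Function.Injective (permGraph (n := n)) := by
  intro π σ h
  ext i
  have : ((i : ℕ), (π i : ℕ)) ∈ permGraph σ := h ▸ mem_permGraph.2 ⟨i, rfl, rfl⟩
  obtain ⟨j, hj, hj'⟩ := mem_permGraph.1 this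
  rw [← hj', Fin.ext hj]

theorem permGraph_mem_partialInjections (π : Perm (Fin n)) :
    permGraph π ∈ partialInjections n n := by
  rw [mem_partialInjections]
  simp only [mem_permGraph]
  refine ⟨?_, ?_⟩
  · rintro p q ⟨i, rfl, rfl⟩
    exact ⟨i.2, (π i).2⟩
  · rintro p q p' q' ⟨i, rfl, rfl⟩ ⟨j, rfl, rfl⟩
    rw [← Fin.ext_iff, ← Fin.ext_iff, π.injective.eq_iff]

theorem exists_permGraph_eq {S : Finset (ℕ × ℕ)} (hS : S ∈ partialInjections n n)
    (hc : S.card = n) : ∃ π : Perm (Fin n), permGraph π = S := by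
  have h0 : ∀ i : Fin n, ∃ v : Fin n, ((i : ℕ), (v : ℕ)) ∈ S := by
    intro i
    have h : openPositions n S = ∅ := by
      rw [← Finset.card_eq_zero, card_openPositions hS, hc, Nat.sub_self]
    by_contra! hi
    have : (i : ℕ) ∈ openPositions n S := by
      rw [mem_openPositions]
      exact ⟨i.2, fun q hq => hi ⟨q, ((mem_partialInjections.1 hS).1 _ _ hq).2⟩ hq⟩
    simp [h] at this
  choose f hf using h0
  have hinj : Function.Injective f := fun i j hij => Fin.ext <|
    ((mem_partialInjections.1 hS).2 _ _ _ _ (hf i) (hf j)).2 (by rw [hij])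
  refine ⟨Equiv.ofBijective f (Finite.injective_iff_bijective.1 hinj), ?_⟩
  refine Finset.eq_of_subset_of_card_le ?_ ?_
  · rintro ⟨p, q⟩ h
    obtain ⟨i, rfl, rfl⟩ := mem_permGraph.1 h
    exact hf i
  · rw [card_permGraph, hc]

theorem forall_lt_exists_iff_rlmin (π : Perm (Fin n)) (i : Fin n) :
    (∀ w < (π i : ℕ), ∃ q < (i : ℕ), (q, w) ∈ permGraph π) ↔ ∀ j, i < j → π i < π j := by
  simp only [mem_permGraph]
  constructor
  · intro h j hj
    by_contra! hlt
    have hne : (π j : ℕ) ≠ π i := fun h => hj.ne' (π.injective (Fin.ext h))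
    obtain ⟨q, hq, k, rfl, hk⟩ := h (π j) (lt_of_le_of_ne hlt hne)
    rw [← Fin.ext_iff, π.injective.eq_iff] at hk
    subst hk
    exact absurd hj (not_lt.2 (le_of_lt hq))
  · intro h w hw
    have hwn : w < n := hw.trans (π i).2
    refine ⟨π.symm ⟨w, hwn⟩, ?_, _, rfl, by simp⟩
    by_contra! hle
    rcases (show i ≤ π.symm ⟨w, hwn⟩ from hle).eq_or_lt with heq | hlt
    · have : π i = ⟨w, hwn⟩ := by rw [heq, apply_symm_apply]
      rw [this] at hw
      exact absurd hw (lt_irrefl _)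
    · have := h _ hlt
      rw [apply_symm_apply, Fin.lt_def] at this
      exact absurd hw (not_lt.2 this.le)

theorem forall_lt_exists_iff_lrmax (π : Perm (Fin n)) (i : Fin n) :
    (∀ q < (i : ℕ), ∃ w < (π i : ℕ), (q, w) ∈ permGraph π) ↔ ∀ j, j < i → π j < π i := by
  simp only [mem_permGraph]
  constructor
  · intro h j hj
    obtain ⟨w, hw, k, hk, rfl⟩ := h j hj
    rw [← Fin.ext hk]
    exact hw
  · intro h q hq
    exact ⟨_, h ⟨q, hq.trans i.2⟩ hq, ⟨q, hq.trans i.2⟩, rfl, rfl⟩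

/-- All entries after position `i` have to fit among the values above `π i`. -/
theorem apply_le_of_rlmin {π : Perm (Fin n)} {i : Fin n} (h : ∀ j, i < j → π i < π j) :
    π i ≤ i := by
  have : (Finset.Ioi i).card ≤ (Finset.Ioi (π i)).card :=
    Finset.card_le_card_of_injOn π (by simpa [Set.MapsTo] using h) π.injective.injOn
  simp only [Fin.card_Ioi] at this
  rw [Fin.le_def]
  omega

/-- The entries before position `i` lie below `π i`. If `π i ≤ i`, they exhaust the values below `π
i`, so none is left for later positions. Thus the non-pivots among left-to-right maxima are the
excedances. -/
theorem rlmin_iff_of_lrmax {π : Perm (Fin n)} {i : Fin n} (h : ∀ j, j < i → π j < π i) :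
    (∀ j, i < j → π i < π j) ↔ π i ≤ i := by
  refine ⟨apply_le_of_rlmin, fun hle j hj => ?_⟩
  have himg : (Finset.Iio i).map π.toEmbedding = Finset.Iio (π i) := by
    refine Finset.eq_of_subset_of_card_le ?_ ?_
    · intro k
      simp only [Finset.mem_map, Finset.mem_Iio, coe_toEmbedding]
      rintro ⟨j, hj, rfl⟩
      exact h j hj
    · simpa using hle
  by_contra! hlt
  have hmem : π j ∈ Finset.Iio (π i) :=
    Finset.mem_Iio.2 (lt_of_le_of_ne hlt fun h => hj.ne' (π.injective h))
  rw [← himg] at hmem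
  simp only [Finset.mem_map, Finset.mem_Iio, coe_toEmbedding, EmbeddingLike.apply_eq_iff_eq,
    exists_eq_right] at hmem
  exact absurd hj hmem.not_gt

variable {R : Type*} [CommRing R]

theorem prod_entryWeight_permGraph (x y : R) (π : Perm (Fin n)) :
    ∏ e ∈ permGraph π, entryWeight x y (permGraph π) e =
      x ^ PermStat.RLmin π * y ^ (PermStat.LRmax π - PermStat.pivot π) := by
  classical
  have hL : PermStat.LRmax π - PermStat.pivot π = (Finset.univ.filter fun i : Fin n =>
      (∀ j, j < i → π j < π i) ∧ ¬ ∀ j, i < j → π i < π j).card := by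
    rw [PermStat.LRmax, PermStat.pivot, Finset.inter_comm, ← Finset.card_sdiff, PermStat.LRMAX,
      PermStat.RLMIN, ← Finset.image_sdiff _ _ π.injective,
      Finset.card_image_of_injective _ π.injective]
    congr 1
    ext i
    simp
  rw [hL, PermStat.RLmin, PermStat.RLMIN, Finset.card_image_of_injective _ π.injective]
  conv_lhs => rw [permGraph]
  rw [Finset.prod_image (permGraph_entry_injective π).injOn, ← Finset.prod_const,
    ← Finset.prod_const, Finset.prod_filter, Finset.prod_filter, ← Finset.prod_mul_distrib]
  refine Finset.prod_congr rfl fun i _ => ?_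
  have h1 := forall_lt_exists_iff_rlmin π i
  have h2 := forall_lt_exists_iff_lrmax π i
  have h3 := apply_le_of_rlmin (π := π) (i := i)
  have h4 := rlmin_iff_of_lrmax (π := π) (i := i)
  simp only [entryWeight]
  simp only [← permGraph.eq_1, h1, h2, ← Fin.le_def]
  by_cases ha : ∀ j, i < j → π i < π j
  · rw [if_pos (h3 ha), if_pos ha, if_neg (fun h => h.2 ha), mul_one]
  · by_cases hb : ∀ j, j < i → π j < π i
    · rw [h4 hb] at ha
      simp [h4 hb, ha, if_pos hb]
    · rw [if_neg ha, if_neg hb, ite_self, one_mul, if_neg (fun h => hb h.1)]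

theorem sum_perm_eq (x y : R) (n : ℕ) :
    ∑ π : Perm (Fin n), x ^ PermStat.RLmin π * y ^ (PermStat.LRmax π - PermStat.pivot π) =
      ((southOp x + westOp x y) ^ n) (Pi.single 0 1) 0 := by
  rw [← partialSum_eq x y n (Pi.single 0 1), partialSum, ← Finset.sum_filter_of_ne (p := fun S : Finset (ℕ × ℕ) => S.card = n)]
  · refine Finset.sum_bij (fun π _ => permGraph π) ?_ ?_ ?_ ?_
    · intro π _
      exact Finset.mem_filter.2 ⟨permGraph_mem_partialInjections π, card_permGraph π⟩
    · intro π _ σ _ h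
      exact permGraph_injective h
    · intro S hS
      obtain ⟨h1, h2⟩ := Finset.mem_filter.1 hS
      obtain ⟨π, hπ⟩ := exists_permGraph_eq h1 h2
      exact ⟨π, Finset.mem_univ _, hπ⟩
    · intro π _
      simp [prod_entryWeight_permGraph, card_permGraph]
  · intro S hS hne
    by_contra hc
    have := card_le_of_mem_partialInjections hS
    refine hne ?_
    -- The factor `Pi.single 0 1 (n - S.card)` kills every partial permutation with an open
    -- position.
    rw [Pi.single_eq_of_ne (by omega), mul_zero]

end Permutations

/-! ### Fillings of a diagram with arbitrary row and column labels, sorted by the content of a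
corner. -/

section Fillings

/-- The fillings of the cells `μ`, given by the set of the cells with a 1, such that every column
in `C` contains a 1 and no 0 has both a 1 above it and a 1 to the left of it. -/
def IsFilling (C : Finset ℕ) (μ S : Finset (ℕ × ℕ)) : Prop :=
  S ⊆ μ ∧ (∀ j ∈ C, ∃ i, (i, j) ∈ S) ∧
    ∀ i j, (i, j) ∈ μ → (i, j) ∉ S → (∃ i' < i, (i', j) ∈ S) → ¬ ∃ j' < j, (i, j') ∈ S

/-- Row `i` has no 0 below a 1. -/
def IsUnrestrictedRow (μ S : Finset (ℕ × ℕ)) (i : ℕ) : Prop :=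
  ∀ j, (i, j) ∈ μ → (i, j) ∉ S → ∀ i' < i, (i', j) ∉ S

/-- Column `j` has no 0 to the right of a 1. -/
def IsUnrestrictedCol (μ S : Finset (ℕ × ℕ)) (j : ℕ) : Prop :=
  ∀ i, (i, j) ∈ μ → (i, j) ∉ S → ∀ j' < j, (i, j') ∉ S

open Classical in
/-- The set of fillings. -/
noncomputable def fillings (C : Finset ℕ) (μ : Finset (ℕ × ℕ)) : Finset (Finset (ℕ × ℕ)) :=
  μ.powerset.filter (IsFilling C μ)

theorem mem_fillings {C : Finset ℕ} {μ S : Finset (ℕ × ℕ)} :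
    S ∈ fillings C μ ↔ IsFilling C μ S := by
  simp only [fillings, Finset.mem_filter, Finset.mem_powerset, and_iff_right_iff_imp]
  exact fun h => h.1

variable {A : Type*} [CommRing A] (x y : A)

open Classical in
/-- The weight of a filling. -/
noncomputable def fillingWeight (R C : Finset ℕ) (μ S : Finset (ℕ × ℕ)) : A :=
  (∏ i ∈ R, if IsUnrestrictedRow μ S i then x else 1) *
    ∏ j ∈ C, if IsUnrestrictedCol μ S j then y else 1

/-- The generating function of the fillings of the diagram with rows `R`, columns `C` and
cells `μ`. -/
noncomputable def fillingSum (R C : Finset ℕ) (μ : Finset (ℕ × ℕ)) : A :=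
  ∑ S ∈ fillings C μ, fillingWeight x y R C μ S

theorem fillingWeight_congr {R C : Finset ℕ} {μ S μ' S' : Finset (ℕ × ℕ)}
    (hR : ∀ i ∈ R, (IsUnrestrictedRow μ S i ↔ IsUnrestrictedRow μ' S' i))
    (hC : ∀ j ∈ C, (IsUnrestrictedCol μ S j ↔ IsUnrestrictedCol μ' S' j)) :
    fillingWeight x y R C μ S = fillingWeight x y R C μ' S' := by
  classical
  unfold fillingWeight
  congr 1
  · exact Finset.prod_congr rfl fun i hi => by simp only [hR i hi]
  · exact Finset.prod_congr rfl fun i hi => by simp only [hC i hi]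

open Classical in
theorem fillingWeight_eq_mul_row {R C : Finset ℕ} {μ S : Finset (ℕ × ℕ)} {i : ℕ} (hi : i ∈ R) :
    fillingWeight x y R C μ S =
      (if IsUnrestrictedRow μ S i then x else 1) * fillingWeight x y (R.erase i) C μ S := by
  rw [fillingWeight, fillingWeight, ← Finset.mul_prod_erase _ _ hi, mul_assoc]

open Classical in
theorem fillingWeight_eq_mul_col {R C : Finset ℕ} {μ S : Finset (ℕ × ℕ)} {j : ℕ} (hj : j ∈ C) :
    fillingWeight x y R C μ S =
      (if IsUnrestrictedCol μ S j then y else 1) * fillingWeight x y R (C.erase j) μ S := by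
  rw [fillingWeight, fillingWeight, ← Finset.mul_prod_erase _ _ hj, mul_left_comm]

theorem fillingSum_eq_zero {R C : Finset ℕ} {μ : Finset (ℕ × ℕ)} {j : ℕ} (hj : j ∈ C)
    (hμ : ∀ i, (i, j) ∉ μ) : fillingSum x y R C μ = 0 := by
  refine Finset.sum_eq_zero fun S hS => ?_
  rw [mem_fillings] at hS
  obtain ⟨i, hi⟩ := hS.2.1 j hj
  exact absurd (hS.1 hi) (hμ i)

theorem fillingSum_empty_row {R C : Finset ℕ} {μ : Finset (ℕ × ℕ)} {i : ℕ} (hi : i ∈ R)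
    (hμ : ∀ j, (i, j) ∉ μ) : fillingSum x y R C μ = x * fillingSum x y (R.erase i) C μ := by
  rw [fillingSum, fillingSum, Finset.mul_sum]
  refine Finset.sum_congr rfl fun S hS => ?_
  rw [fillingWeight_eq_mul_row x y hi, if_pos]
  intro j hj
  exact absurd hj (hμ j)

/-- `(i, j)` is a south-east corner of the diagram `μ`. -/
structure IsOuterCorner (R C : Finset ℕ) (μ : Finset (ℕ × ℕ)) (i j : ℕ) : Prop where
  row_mem : i ∈ R
  col_mem : j ∈ C
  mem : (i, j) ∈ μ
  mem_rows : ∀ i' j', (i', j') ∈ μ → i' ∈ R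
  mem_cols : ∀ i' j', (i', j') ∈ μ → j' ∈ C
  row_le : ∀ i' j', (i', j') ∈ μ → j ≤ j' → i' ≤ i
  col_le : ∀ i' j', (i', j') ∈ μ → i ≤ i' → j' ≤ j
  col_mem_of_lt : ∀ i' ∈ R, i' < i → (i', j) ∈ μ

namespace IsOuterCorner

variable {R C : Finset ℕ} {μ : Finset (ℕ × ℕ)} {i j : ℕ}

-- Column `j` has a 1, necessarily above the corner. A 0 in the corner therefore forces row `i` to
-- be all 0; the row is restricted, has weight 1, and imposes nothing on the rest.
open Classical in
theorem sum_corner_zero (h : IsOuterCorner R C μ i j) :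
    ∑ S ∈ (fillings C μ).filter (fun S => (i, j) ∉ S), fillingWeight x y R C μ S =
      fillingSum x y (R.erase i) C (μ.filter fun e => e.1 ≠ i) := by
  obtain ⟨h1, h2, h3, h4, h5, h6, h7, h8⟩ := h
  rw [fillingSum]
  refine Finset.sum_congr ?_ ?_
  · ext S
    simp only [Finset.mem_filter, mem_fillings, IsFilling, Finset.subset_iff, Prod.forall]
    constructor
    · rintro ⟨⟨g1, g2, g3⟩, g4⟩
      have hrow : ∀ j', (i, j') ∉ S := by
        intro j' hj'
        obtain ⟨i', hi'⟩ := g2 j h2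
        have := h6 i' j (g1 _ _ hi') le_rfl
        have := h7 i j' (g1 _ _ hj') le_rfl
        refine g3 i j h3 g4 ⟨i', ?_, hi'⟩ ⟨j', ?_, hj'⟩ <;> grind
      grind
    · rintro ⟨g1, g2, g3⟩
      grind
  · intro S hS
    simp only [mem_fillings, IsFilling, Finset.subset_iff, Prod.forall, Finset.mem_filter] at hS
    obtain ⟨g1, g2, g3⟩ := hS
    rw [fillingWeight_eq_mul_row x y h1, if_neg, one_mul]
    · apply fillingWeight_congr
      · intro a ha
        simp only [IsUnrestrictedRow, Finset.mem_filter]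
        grind
      · intro b hb
        simp only [IsUnrestrictedCol, Finset.mem_filter]
        grind
    · intro hu
      obtain ⟨i', hi'⟩ := g2 j h2
      have := h6 i' j (g1 _ _ hi').1 le_rfl
      exact hu j h3 (by grind) i' (by grind) hi'

-- No cell lies below the corner or to its right, so its 1 restricts nothing; column `j` keeps a 1
-- when the corner is removed.
open Classical in
theorem sum_corner_one_of_exists (h : IsOuterCorner R C μ i j) :
    ∑ S ∈ (fillings C μ).filter (fun S => (i, j) ∈ S ∧ ∃ i', i' ≠ i ∧ (i', j) ∈ S),
      fillingWeight x y R C μ S = fillingSum x y R C (μ.erase (i, j)) := by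
  obtain ⟨h1, h2, h3, h4, h5, h6, h7, h8⟩ := h
  rw [fillingSum]
  refine Finset.sum_bij' (fun S _ => S.erase (i, j)) (fun S _ => insert (i, j) S) ?_ ?_ ?_ ?_ ?_
  · intro S
    simp only [mem_fillings, IsFilling, Finset.subset_iff, Prod.forall, Finset.mem_filter]
    rintro ⟨⟨g1, g2, g3⟩, g4, i₀, g5, g6⟩
    refine ⟨by grind, ?_, by grind⟩
    intro b hb
    by_cases hbj : b = j
    · exact ⟨i₀, by grind⟩
    · obtain ⟨a, ha⟩ := g2 b hb
      exact ⟨a, by grind⟩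
  · intro S
    simp only [mem_fillings, IsFilling, Finset.subset_iff, Prod.forall, Finset.mem_filter]
    rintro ⟨g1, g2, g3⟩
    refine ⟨⟨by grind, by grind, ?_⟩, by grind, ?_⟩
    · intro a b hab hS
      grind
    · obtain ⟨a, ha⟩ := g2 j h2
      exact ⟨a, by grind⟩
  · intro S hS
    simp only [Finset.mem_filter] at hS
    exact Finset.insert_erase hS.2.1
  · intro S hS
    rw [mem_fillings] at hS
    exact Finset.erase_insert fun hmem => by simpa using hS.1 hmem
  · intro S
    simp only [mem_fillings, IsFilling, Finset.subset_iff, Prod.forall, Finset.mem_filter]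
    rintro ⟨⟨g1, g2, g3⟩, g4, -⟩
    apply fillingWeight_congr
    · intro a ha
      simp only [IsUnrestrictedRow, Finset.mem_erase, ne_eq, Prod.mk.injEq]
      constructor
      · intro hu b hab haS a' ha' haS'
        exact hu b hab.2 (fun h => haS ⟨hab.1, h⟩) a' ha' haS'.2
      · intro hu b hab haS a' ha' haS'
        refine hu b ⟨?_, hab⟩ (fun h => haS h.2) a' ha' ⟨?_, haS'⟩
        · rintro ⟨rfl, rfl⟩
          exact haS g4
        · rintro ⟨rfl, rfl⟩
          exact absurd (h6 a b hab le_rfl) (not_le.2 ha')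
    · intro b hb
      simp only [IsUnrestrictedCol, Finset.mem_erase, ne_eq, Prod.mk.injEq]
      constructor
      · intro hu a hab haS b' hb' hbS'
        exact hu a hab.2 (fun h => haS ⟨hab.1, h⟩) b' hb' hbS'.2
      · intro hu a hab haS b' hb' hbS'
        refine hu a ⟨?_, hab⟩ (fun h => haS h.2) b' hb' ⟨?_, hbS'⟩
        · rintro ⟨rfl, rfl⟩
          exact haS g4
        · rintro ⟨rfl, rfl⟩
          exact absurd (h7 a b hab le_rfl) (not_le.2 hb')

-- The only 1 of column `j` is at its bottom, so its 0's restrict no row and the column can be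
-- removed. It is unrestricted exactly when there is no 1 strictly north-west of the corner.
open Classical in
theorem sum_corner_one_of_not_exists (h : IsOuterCorner R C μ i j) :
    ∑ S ∈ (fillings C μ).filter (fun S => (i, j) ∈ S ∧ ¬ ∃ i', i' ≠ i ∧ (i', j) ∈ S),
      fillingWeight x y R C μ S =
    ∑ S ∈ fillings (C.erase j) (μ.filter fun e => e.2 ≠ j),
      (if ∀ i' < i, ∀ j' < j, (i', j') ∉ S then y else 1) *
        fillingWeight x y R (C.erase j) (μ.filter fun e => e.2 ≠ j) S := by
  obtain ⟨h1, h2, h3, h4, h5, h6, h7, h8⟩ := h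
  refine Finset.sum_bij' (fun S _ => S.erase (i, j)) (fun S _ => insert (i, j) S) ?_ ?_ ?_ ?_ ?_
  · intro S
    simp only [mem_fillings, IsFilling, Finset.subset_iff, Prod.forall, Finset.mem_filter]
    rintro ⟨⟨g1, g2, g3⟩, g4, g5⟩
    refine ⟨by grind, ?_, by grind⟩
    intro b hb
    obtain ⟨a, ha⟩ := g2 b (Finset.mem_of_mem_erase hb)
    exact ⟨a, by grind⟩
  · intro S
    simp only [mem_fillings, IsFilling, Finset.subset_iff, Prod.forall, Finset.mem_filter]
    rintro ⟨g1, g2, g3⟩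
    refine ⟨⟨by grind, ?_, ?_⟩, by grind, ?_⟩
    · intro b hb
      by_cases hbj : b = j
      · exact ⟨i, by grind⟩
      · obtain ⟨a, ha⟩ := g2 b (Finset.mem_erase.2 ⟨hbj, hb⟩)
        exact ⟨a, by grind⟩
    · intro a b hab hS
      grind
    · grind
  · intro S hS
    simp only [Finset.mem_filter] at hS
    exact Finset.insert_erase hS.2.1
  · intro S hS
    rw [mem_fillings] at hS
    exact Finset.erase_insert fun hmem => by simpa using hS.1 hmem
  · intro S
    simp only [mem_fillings, IsFilling, Finset.subset_iff, Prod.forall, Finset.mem_filter]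
    rintro ⟨⟨g1, g2, g3⟩, g4, g5⟩
    rw [fillingWeight_eq_mul_col x y h2]
    congr 1
    · congr 1
      simp only [IsUnrestrictedCol, Finset.mem_erase, eq_iff_iff]
      constructor
      · intro hu a ha b hb hab
        exact hu a (h8 a (h4 a b (g1 _ _ hab.2)) ha) (by grind) b hb hab.2
      · intro hu a ha haS b hb hab
        exact hu a (by grind) b hb (by grind)
    · apply fillingWeight_congr
      · intro a ha
        simp only [IsUnrestrictedRow, Finset.mem_erase, Finset.mem_filter]
        grind
      · intro b hb
        simp only [IsUnrestrictedCol, Finset.mem_erase, Finset.mem_filter]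
        grind

end IsOuterCorner

end Fillings

/-! ### Decoupling at a corner, and the corner recursion. -/

namespace IsOuterCorner

variable {A : Type*} [CommRing A] (x y : A)

variable {R C : Finset ℕ} {μ : Finset (ℕ × ℕ)} {i j : ℕ}

-- With the north-west region all 0, no 1 to the right of column `j` shares a row or a column with a
-- 1 to its left, and the 0's of that region are restricted neither by row nor by column.
open Classical in
theorem fillingWeight_split (h : IsOuterCorner R C μ i j) {S : Finset (ℕ × ℕ)}
    (hS : IsFilling (C.erase j) (μ.filter fun e => e.2 ≠ j) S)
    (hN : ∀ i' < i, ∀ j' < j, (i', j') ∉ S) :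
    fillingWeight x y R (C.erase j) (μ.filter fun e => e.2 ≠ j) S =
      fillingWeight x y (R.filter fun a => a < i) (C.filter fun b => j < b)
          (μ.filter fun e => j < e.2) (S.filter fun e => j < e.2) *
        fillingWeight x y (R.filter fun a => i ≤ a) (C.filter fun b => b < j)
          (μ.filter fun e => i ≤ e.1 ∧ e.2 < j) (S.filter fun e => e.2 < j) := by
  obtain ⟨h1, h2, h3, h4, h5, h6, h7, h8⟩ := h
  simp only [IsFilling, Finset.subset_iff, Prod.forall, Finset.mem_filter] at hS
  obtain ⟨g1, g2, g3⟩ := hS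
  unfold fillingWeight
  rw [mul_mul_mul_comm]
  congr 1
  · rw [← Finset.prod_filter_mul_prod_filter_not R (fun a => a < i)]
    simp only [not_lt]
    congr 1
    · refine Finset.prod_congr rfl fun a ha => ?_
      have ha' := (Finset.mem_filter.1 ha).2
      congr 1
      simp only [IsUnrestrictedRow, Finset.mem_filter, eq_iff_iff]
      constructor
      · intro hu b hab haS a' haa' haS'
        exact hu b (by grind) (by grind) a' haa' haS'.1
      · intro hu b hab haS a' haa' haS'
        by_cases hb : b < j
        · exact hN a' (by omega) b hb haS'
        · exact hu b (by grind) (by grind) a' haa' (by grind)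
    · refine Finset.prod_congr rfl fun a ha => ?_
      have ha' := (Finset.mem_filter.1 ha).2
      congr 1
      simp only [IsUnrestrictedRow, Finset.mem_filter, eq_iff_iff]
      constructor
      · intro hu b hab haS a' haa' haS'
        exact hu b (by grind) (by grind) a' haa' haS'.1
      · intro hu b hab haS a' haa' haS'
        have := h7 a b hab.1 ha'
        exact hu b (by grind) (by grind) a' haa' (by grind)
  · rw [← Finset.prod_filter_mul_prod_filter_not (C.erase j) (fun b => j < b)]
    congr 1
    · rw [show (C.erase j).filter (fun b => j < b) = C.filter fun b => j < b by ext; grind]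
      refine Finset.prod_congr rfl fun b hb => ?_
      have hb' := (Finset.mem_filter.1 hb).2
      congr 1
      simp only [IsUnrestrictedCol, Finset.mem_filter, eq_iff_iff]
      constructor
      · intro hu a hab haS b' hbb' hbS'
        exact hu a (by grind) (by grind) b' hbb' hbS'.1
      · intro hu a hab haS b' hbb' hbS'
        by_cases hbj : b' < j
        · have := hN a
          have := h7 a b hab.1
          grind
        · exact hu a (by grind) (by grind) b' hbb' (by grind)
    · rw [show (C.erase j).filter (fun b => ¬ j < b) = C.filter fun b => b < j by ext; grind]
      refine Finset.prod_congr rfl fun b hb => ?_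
      have hb' := (Finset.mem_filter.1 hb).2
      congr 1
      simp only [IsUnrestrictedCol, Finset.mem_filter, eq_iff_iff]
      constructor
      · intro hu a hab haS b' hbb' hbS'
        exact hu a (by grind) (by grind) b' hbb' hbS'.1
      · intro hu a hab haS b' hbb' hbS'
        by_cases hai : a < i
        · exact hN a hai b' (by omega) hbS'
        · exact hu a (by grind) (by grind) b' hbb' (by grind)

open Classical in
theorem sum_noncrossing (h : IsOuterCorner R C μ i j) :
    ∑ S ∈ (fillings (C.erase j) (μ.filter fun e => e.2 ≠ j)).filter
        (fun S => ∀ i' < i, ∀ j' < j, (i', j') ∉ S),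
      fillingWeight x y R (C.erase j) (μ.filter fun e => e.2 ≠ j) S =
    fillingSum x y (R.filter fun a => a < i) (C.filter fun b => j < b)
        (μ.filter fun e => j < e.2) *
      fillingSum x y (R.filter fun a => i ≤ a) (C.filter fun b => b < j)
        (μ.filter fun e => i ≤ e.1 ∧ e.2 < j) := by
  have hcorner := h
  obtain ⟨h1, h2, h3, h4, h5, h6, h7, h8⟩ := h
  rw [fillingSum, fillingSum, Finset.sum_mul_sum, ← Finset.sum_product']
  refine Finset.sum_bij' (fun S _ => (S.filter fun e => j < e.2, S.filter fun e => e.2 < j))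
    (fun P _ => P.1 ∪ P.2) ?_ ?_ ?_ ?_ ?_
  · intro S
    simp only [mem_fillings, IsFilling, Finset.subset_iff, Prod.forall, Finset.mem_filter,
      Finset.mem_product]
    rintro ⟨⟨g1, g2, g3⟩, g4⟩
    refine ⟨⟨by grind, ?_, ?_⟩, by grind, ?_, ?_⟩
    · intro b hb
      obtain ⟨a, ha⟩ := g2 b (by grind)
      exact ⟨a, ha, hb.2⟩
    · rintro a b hab haS ⟨a', ha', haS'⟩ ⟨b', hb', hbS'⟩
      exact g3 a b (by grind) (by grind) ⟨a', ha', haS'.1⟩ ⟨b', hb', hbS'.1⟩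
    · intro b hb
      obtain ⟨a, ha⟩ := g2 b (by grind)
      exact ⟨a, ha, hb.2⟩
    · rintro a b hab haS ⟨a', ha', haS'⟩ ⟨b', hb', hbS'⟩
      exact g3 a b (by grind) (by grind) ⟨a', ha', haS'.1⟩ ⟨b', hb', hbS'.1⟩
  · rintro ⟨S, S'⟩
    simp only [mem_fillings, IsFilling, Finset.subset_iff, Prod.forall, Finset.mem_filter,
      Finset.mem_product, Finset.mem_union]
    rintro ⟨⟨g1, g2, g3⟩, k1, k2, k3⟩
    refine ⟨⟨by grind, ?_, ?_⟩, by grind⟩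
    · intro b hb
      by_cases hbj : j < b
      · obtain ⟨a, ha⟩ := g2 b (by grind)
        exact ⟨a, Or.inl ha⟩
      · obtain ⟨a, ha⟩ := k2 b (by grind)
        exact ⟨a, Or.inr ha⟩
    · rintro a b hab haS ⟨a', ha', haS'⟩ ⟨b', hb', hbS'⟩
      by_cases hbj : j < b
      -- To the right of column `j` every cell is above row `i`, by the corner property.
      · have hai : a < i := by
          by_contra hai
          have := h7 a b hab.1 (by omega)
          omega
        refine g3 a b ⟨hab.1, hbj⟩ (by grind) ⟨a', ha', by grind⟩ ⟨b', hb', ?_⟩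
        rcases hbS' with hbS' | hbS'
        · exact hbS'
        · have := (k1 _ _ hbS').2
          omega
      · have haS2 : (a', b) ∈ S' := by
          rcases haS' with haS' | haS'
          · exact absurd (g1 _ _ haS').2 hbj
          · exact haS'
        have := (k1 _ _ haS2).2
        refine k3 a b ⟨hab.1, by omega, by omega⟩ (by grind) ⟨a', ha', haS2⟩ ⟨b', hb', ?_⟩
        rcases hbS' with hbS' | hbS'
        · have := (g1 _ _ hbS').2
          omega
        · exact hbS'
  · intro S
    simp only [mem_fillings, IsFilling, Finset.subset_iff, Prod.forall, Finset.mem_filter]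
    rintro ⟨⟨g1, -⟩, -⟩
    ext ⟨a, b⟩
    simp only [Finset.mem_union, Finset.mem_filter]
    grind
  · rintro ⟨S, S'⟩
    simp only [mem_fillings, IsFilling, Finset.subset_iff, Prod.forall, Finset.mem_filter,
      Finset.mem_product, Prod.mk.injEq]
    rintro ⟨⟨g1, -⟩, k1, -⟩
    constructor
    · ext ⟨a, b⟩
      simp only [Finset.mem_union, Finset.mem_filter]
      grind
    · ext ⟨a, b⟩
      simp only [Finset.mem_union, Finset.mem_filter]
      grind
  · intro S hS
    rw [Finset.mem_filter, mem_fillings] at hS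
    exact fillingWeight_split x y hcorner hS.1 hS.2

/-- The recursion that removes a south-east corner of the diagram. -/
theorem fillingSum_eq (h : IsOuterCorner R C μ i j) :
    fillingSum x y R C μ = fillingSum x y R C (μ.erase (i, j)) +
      fillingSum x y (R.erase i) C (μ.filter fun e => e.1 ≠ i) +
      fillingSum x y R (C.erase j) (μ.filter fun e => e.2 ≠ j) +
      (y - 1) * (fillingSum x y (R.filter fun a => a < i) (C.filter fun b => j < b)
        (μ.filter fun e => j < e.2) *
      fillingSum x y (R.filter fun a => i ≤ a) (C.filter fun b => b < j)
        (μ.filter fun e => i ≤ e.1 ∧ e.2 < j)) := by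
  classical
  rw [← sum_corner_zero x y h, ← sum_corner_one_of_exists x y h, ← sum_noncrossing x y h]
  have h1 := sum_corner_one_of_not_exists x y h
  have h2 : fillingSum x y R C μ =
      ∑ S ∈ (fillings C μ).filter (fun S => (i, j) ∈ S ∧ ∃ i', i' ≠ i ∧ (i', j) ∈ S),
        fillingWeight x y R C μ S +
      ∑ S ∈ (fillings C μ).filter (fun S => (i, j) ∈ S ∧ ¬ ∃ i', i' ≠ i ∧ (i', j) ∈ S),
        fillingWeight x y R C μ S +
      ∑ S ∈ (fillings C μ).filter (fun S => (i, j) ∉ S), fillingWeight x y R C μ S := by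
    rw [fillingSum, ← Finset.sum_filter_add_sum_filter_not _ (fun S => (i, j) ∈ S)]
    congr 1
    rw [← Finset.sum_filter_add_sum_filter_not _ (fun S => ∃ i', i' ≠ i ∧ (i', j) ∈ S),
      Finset.filter_filter, Finset.filter_filter]
  -- Writing `y = 1 + (y - 1)` separates all fillings from those with an empty north-west region.
  have h3 : ∑ S ∈ fillings (C.erase j) (μ.filter fun e => e.2 ≠ j),
      (if ∀ i' < i, ∀ j' < j, (i', j') ∉ S then y else 1) *
        fillingWeight x y R (C.erase j) (μ.filter fun e => e.2 ≠ j) S =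
      fillingSum x y R (C.erase j) (μ.filter fun e => e.2 ≠ j) +
      (y - 1) * ∑ S ∈ (fillings (C.erase j) (μ.filter fun e => e.2 ≠ j)).filter
        (fun S => ∀ i' < i, ∀ j' < j, (i', j') ∉ S),
      fillingWeight x y R (C.erase j) (μ.filter fun e => e.2 ≠ j) S := by
    rw [fillingSum, Finset.mul_sum, Finset.sum_filter, ← Finset.sum_add_distrib]
    refine Finset.sum_congr rfl fun S _ => ?_
    split_ifs <;> ring
  rw [h2, h1, h3]
  ring

end IsOuterCorner

/-! ### Border paths as words in the two operators. -/

section BorderPaths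

/-- The labels of the south steps (the rows) of a border path. -/
def pathRows (l : List (ℕ ⊕ ℕ)) : Finset ℕ := (l.filterMap Sum.getLeft?).toFinset

/-- The labels of the west steps (the columns) of a border path. -/
def pathCols (l : List (ℕ ⊕ ℕ)) : Finset ℕ := (l.filterMap Sum.getRight?).toFinset

/-- The cells of the diagram with a given border path: a row meets the columns whose west steps
come later. -/
def pathCells : List (ℕ ⊕ ℕ) → Finset (ℕ × ℕ)
  | [] => ∅
  | Sum.inl i :: l => (pathCols l).image (fun j => (i, j)) ∪ pathCells l
  | Sum.inr _ :: l => pathCells l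

theorem mem_pathRows {l : List (ℕ ⊕ ℕ)} {i : ℕ} : i ∈ pathRows l ↔ Sum.inl i ∈ l := by
  simp [pathRows]

theorem mem_pathCols {l : List (ℕ ⊕ ℕ)} {j : ℕ} : j ∈ pathCols l ↔ Sum.inr j ∈ l := by
  simp [pathCols]

theorem mem_pathCells_inl {l : List (ℕ ⊕ ℕ)} {i a b : ℕ} :
    (a, b) ∈ pathCells (Sum.inl i :: l) ↔ a = i ∧ Sum.inr b ∈ l ∨ (a, b) ∈ pathCells l := by
  simp only [pathCells, Finset.mem_union, Finset.mem_image, mem_pathCols, Prod.mk.injEq]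
  grind

theorem mem_pathCells_inr {l : List (ℕ ⊕ ℕ)} {j a b : ℕ} :
    (a, b) ∈ pathCells (Sum.inr j :: l) ↔ (a, b) ∈ pathCells l := Iff.rfl

theorem mem_of_mem_pathCells {l : List (ℕ ⊕ ℕ)} {a b : ℕ} (h : (a, b) ∈ pathCells l) :
    Sum.inl a ∈ l ∧ Sum.inr b ∈ l := by
  induction l with
  | nil => simp [pathCells] at h
  | cons s l ih =>
    rcases s with i | j
    · rw [mem_pathCells_inl] at h
      grind
    · rw [mem_pathCells_inr] at h
      grind

theorem mem_pathCells_append {u v : List (ℕ ⊕ ℕ)} {a b : ℕ} :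
    (a, b) ∈ pathCells (u ++ v) ↔
      (a, b) ∈ pathCells u ∨ (a, b) ∈ pathCells v ∨ Sum.inl a ∈ u ∧ Sum.inr b ∈ v := by
  induction u with
  | nil => simp [pathCells]
  | cons s u ih =>
    rcases s with i | j
    · rw [List.cons_append, mem_pathCells_inl, mem_pathCells_inl, ih]
      grind
    · rw [List.cons_append, mem_pathCells_inr, mem_pathCells_inr, ih]
      grind

/-- The order of the labels along a border path: rows increase and columns decrease. -/
def StepRel : ℕ ⊕ ℕ → ℕ ⊕ ℕ → Prop
  | Sum.inl a, Sum.inl b => a < b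
  | Sum.inr a, Sum.inr b => b < a
  | _, _ => True

variable {A : Type*} [CommRing A] (x y : A)

/-- The product of the operators of the steps of a path. -/
def pathOp (l : List (ℕ ⊕ ℕ)) : Module.End A (ℕ → A) :=
  (l.map (Sum.elim (fun _ => southOp x) (fun _ => westOp x y))).prod

/-- The generating function of the fillings of the diagram below a border path. -/
noncomputable def pathSum (l : List (ℕ ⊕ ℕ)) : A :=
  fillingSum x y (pathRows l) (pathCols l) (pathCells l)

theorem pathSum_corner {u v : List (ℕ ⊕ ℕ)} {i j : ℕ}
    (h : (u ++ Sum.inl i :: Sum.inr j :: v).Pairwise StepRel) :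
    pathSum x y (u ++ Sum.inl i :: Sum.inr j :: v) =
      pathSum x y (u ++ Sum.inr j :: Sum.inl i :: v) + pathSum x y (u ++ Sum.inr j :: v) +
        pathSum x y (u ++ Sum.inl i :: v) +
        (y - 1) * (pathSum x y u * pathSum x y (Sum.inl i :: v)) := by
  rw [List.pairwise_append, List.pairwise_cons, List.pairwise_cons] at h
  obtain ⟨-, ⟨hi, hj, -⟩, hu⟩ := h
  have r1 : ∀ a, Sum.inl a ∈ u → a < i := fun a ha => hu _ ha (Sum.inl i) (by simp)
  have r2 : ∀ a, Sum.inl a ∈ v → i < a := fun a ha => hi (Sum.inl a) (by simp [ha])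
  have r3 : ∀ b, Sum.inr b ∈ u → j < b := fun b hb => hu _ hb (Sum.inr j) (by simp)
  have r4 : ∀ b, Sum.inr b ∈ v → b < j := fun b hb => hj (Sum.inr b) hb
  have m1 : ∀ a b, (a, b) ∈ pathCells u → Sum.inl a ∈ u ∧ Sum.inr b ∈ u :=
    fun a b => mem_of_mem_pathCells
  have m2 : ∀ a b, (a, b) ∈ pathCells v → Sum.inl a ∈ v ∧ Sum.inr b ∈ v :=
    fun a b => mem_of_mem_pathCells
  have hc : IsOuterCorner (pathRows (u ++ Sum.inl i :: Sum.inr j :: v))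
      (pathCols (u ++ Sum.inl i :: Sum.inr j :: v))
      (pathCells (u ++ Sum.inl i :: Sum.inr j :: v)) i j := by
    constructor <;>
    simp only [mem_pathRows, mem_pathCols, mem_pathCells_append, mem_pathCells_inl,
      mem_pathCells_inr, List.mem_append, List.mem_cons, reduceCtorEq, Sum.inl.injEq,
      Sum.inr.injEq, false_or] <;>
    grind
  unfold pathSum
  rw [hc.fillingSum_eq x y]
  congr 1
  · congr 1
    · congr 1
      · congr 1
        · ext a
          simp only [mem_pathRows, List.mem_append, List.mem_cons, reduceCtorEq, false_or]
        · ext a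
          simp only [mem_pathCols, List.mem_append, List.mem_cons, reduceCtorEq, false_or]
        · ext ⟨a, b⟩
          simp only [Finset.mem_erase, mem_pathCells_append, mem_pathCells_inl,
            mem_pathCells_inr, List.mem_cons, reduceCtorEq, Sum.inr.injEq, false_or, ne_eq,
            Prod.mk.injEq]
          grind
      · congr 1
        · ext a
          simp only [Finset.mem_erase, mem_pathRows, List.mem_append, List.mem_cons,
            reduceCtorEq, Sum.inl.injEq, false_or]
          grind
        · ext a
          simp only [mem_pathCols, List.mem_append, List.mem_cons, reduceCtorEq, false_or]
        · ext ⟨a, b⟩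
          simp only [Finset.mem_filter, mem_pathCells_append, mem_pathCells_inl,
            mem_pathCells_inr, List.mem_cons, reduceCtorEq, Sum.inr.injEq, false_or, ne_eq]
          grind
    · congr 1
      · ext a
        simp only [mem_pathRows, List.mem_append, List.mem_cons, reduceCtorEq, false_or]
      · ext a
        simp only [Finset.mem_erase, mem_pathCols, List.mem_append, List.mem_cons,
          reduceCtorEq, Sum.inr.injEq, false_or]
        grind
      · ext ⟨a, b⟩
        simp only [Finset.mem_filter, mem_pathCells_append, mem_pathCells_inl,
          mem_pathCells_inr, List.mem_cons, reduceCtorEq, Sum.inr.injEq, false_or, ne_eq]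
        grind
  · congr 2
    · congr 1
      · ext a
        simp only [Finset.mem_filter, mem_pathRows, List.mem_append, List.mem_cons,
          reduceCtorEq, Sum.inl.injEq, false_or]
        grind
      · ext a
        simp only [Finset.mem_filter, mem_pathCols, List.mem_append, List.mem_cons,
          reduceCtorEq, Sum.inr.injEq, false_or]
        grind
      · ext ⟨a, b⟩
        simp only [Finset.mem_filter, mem_pathCells_append, mem_pathCells_inl,
          mem_pathCells_inr, List.mem_cons, reduceCtorEq, Sum.inr.injEq, false_or]
        grind
    · congr 1
      · ext a
        simp only [Finset.mem_filter, mem_pathRows, List.mem_append, List.mem_cons,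
          reduceCtorEq, Sum.inl.injEq, false_or]
        grind
      · ext a
        simp only [Finset.mem_filter, mem_pathCols, List.mem_append, List.mem_cons,
          reduceCtorEq, Sum.inr.injEq, false_or]
        grind
      · ext ⟨a, b⟩
        simp only [Finset.mem_filter, mem_pathCells_append, mem_pathCells_inl,
          mem_pathCells_inr, List.mem_cons, reduceCtorEq, Sum.inr.injEq, false_or]
        grind

/-- A word that starts with a south step and ends with a west step has a south step directly
followed by a west step. -/
theorem path_cases (l : List (ℕ ⊕ ℕ)) :
    l = [] ∨ (∃ j v, l = Sum.inr j :: v) ∨ (∃ u i, l = u ++ [Sum.inl i]) ∨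
      ∃ u i j v, l = u ++ Sum.inl i :: Sum.inr j :: v := by
  induction l with
  | nil => exact Or.inl rfl
  | cons s l ih =>
    rcases s with i | j
    · rcases ih with rfl | ⟨j, v, rfl⟩ | ⟨u, i', rfl⟩ | ⟨u, i', j, v, rfl⟩
      · exact Or.inr (Or.inr (Or.inl ⟨[], i, rfl⟩))
      · exact Or.inr (Or.inr (Or.inr ⟨[], i, j, v, rfl⟩))
      · exact Or.inr (Or.inr (Or.inl ⟨Sum.inl i :: u, i', rfl⟩))
      · exact Or.inr (Or.inr (Or.inr ⟨Sum.inl i :: u, i', j, v, rfl⟩))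
    · exact Or.inr (Or.inl ⟨j, l, rfl⟩)

theorem pathSum_nil : pathSum x y [] = 1 := by
  have : fillings ∅ ∅ = {∅} := by
    ext S
    rw [mem_fillings, Finset.mem_singleton]
    constructor
    · exact fun h => Finset.subset_empty.1 h.1
    · rintro rfl
      simp [IsFilling]
  simp [pathSum, pathRows, pathCols, pathCells, fillingSum, this, fillingWeight]

/-- A leading west step is a column without cells, which cannot contain a 1. -/
theorem pathSum_inr_cons {j : ℕ} {v : List (ℕ ⊕ ℕ)}
    (h : (Sum.inr j :: v).Pairwise StepRel) : pathSum x y (Sum.inr j :: v) = 0 := by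
  refine fillingSum_eq_zero x y (j := j) (by simp [mem_pathCols]) fun i hi => ?_
  rw [mem_pathCells_inr] at hi
  exact lt_irrefl j ((List.pairwise_cons.1 h).1 _ (mem_of_mem_pathCells hi).2)

theorem pathSum_append_inl {i : ℕ} {u : List (ℕ ⊕ ℕ)}
    (h : (u ++ [Sum.inl i]).Pairwise StepRel) :
    pathSum x y (u ++ [Sum.inl i]) = x * pathSum x y u := by
  have hu : Sum.inl i ∉ u := fun hi =>
    lt_irrefl i ((List.pairwise_append.1 h).2.2 _ hi (Sum.inl i) (by simp))
  have hcells : pathCells (u ++ [Sum.inl i]) = pathCells u := by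
    ext ⟨a, b⟩
    rw [mem_pathCells_append, mem_pathCells_inl]
    simp [pathCells]
  have hcols : pathCols (u ++ [Sum.inl i]) = pathCols u := by
    ext a
    simp [mem_pathCols]
  have hrows : (pathRows (u ++ [Sum.inl i])).erase i = pathRows u := by
    ext a
    simp only [Finset.mem_erase, mem_pathRows, List.mem_append, List.mem_singleton,
      Sum.inl.injEq]
    grind
  unfold pathSum
  rw [hcells, hcols, fillingSum_empty_row x y (i := i), hrows]
  · simp [mem_pathRows]
  · exact fun j hj => hu (mem_of_mem_pathCells hj).1

/-- The operator counterpart of `pathSum_corner`: at `h = Pi.single 0 1`, evaluated at 0, the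
rank-one term factors in the same way. -/
theorem pathOp_corner (u v : List (ℕ ⊕ ℕ)) (i j : ℕ) (h : ℕ → A) :
    pathOp x y (u ++ Sum.inl i :: Sum.inr j :: v) h =
      pathOp x y (u ++ Sum.inr j :: Sum.inl i :: v) h + pathOp x y (u ++ Sum.inr j :: v) h +
        pathOp x y (u ++ Sum.inl i :: v) h +
        ((y - 1) * pathOp x y (Sum.inl i :: v) h 0) • pathOp x y u (Pi.single 0 1) := by
  simp only [pathOp, List.map_append, List.map_cons, List.prod_append, List.prod_cons,
    Sum.elim_inl, Sum.elim_inr, Module.End.mul_apply, southOp_westOp, map_add, map_smul]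

theorem pathSum_eq (l : List (ℕ ⊕ ℕ)) (hl : l.Pairwise StepRel) :
    pathSum x y l = pathOp x y l (Pi.single 0 1) 0 := by
  -- Exchanging the two steps of a corner keeps the length and loses a cell; the other words of the
  -- recursion are shorter and have no more cells.
  induction hn : l.length + (pathCells l).card using Nat.strong_induction_on generalizing l with
  | _ n ih =>
  subst hn
  rcases path_cases l with rfl | ⟨j, v, rfl⟩ | ⟨u, i, rfl⟩ | ⟨u, i, j, v, rfl⟩
  · simp [pathSum_nil, pathOp]
  · rw [pathSum_inr_cons x y hl]
    simp [pathOp, westOp_apply_zero]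
  · rw [pathSum_append_inl x y hl, ih _ ?_ u (List.pairwise_append.1 hl).1 rfl]
    · simp [pathOp, southOp_single]
    · have : pathCells u ⊆ pathCells (u ++ [Sum.inl i]) := fun ⟨a, b⟩ hab =>
        mem_pathCells_append.2 (Or.inl hab)
      have := Finset.card_le_card this
      simp only [List.length_append, List.length_singleton]
      omega
  · have hp := hl
    have hsub : ∀ l' : List (ℕ ⊕ ℕ), l'.Sublist (u ++ Sum.inl i :: Sum.inr j :: v) → l'.Pairwise StepRel :=
      fun l' h => hl.sublist h
    have s1 : (u ++ Sum.inr j :: v).Sublist (u ++ Sum.inl i :: Sum.inr j :: v) :=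
      (List.sublist_cons_self _ _).append_left u
    have s2 : (u ++ Sum.inl i :: v).Sublist (u ++ Sum.inl i :: Sum.inr j :: v) :=
      ((List.sublist_cons_self _ _).cons_cons _).append_left u
    have s3 : u.Sublist (u ++ Sum.inl i :: Sum.inr j :: v) := List.sublist_append_left _ _
    have s4 : (Sum.inl i :: v).Sublist (u ++ Sum.inl i :: Sum.inr j :: v) :=
      (List.sublist_append_right u _).trans s2
    rw [List.pairwise_append, List.pairwise_cons, List.pairwise_cons] at hp
    obtain ⟨pu, ⟨hi, hj, pv⟩, hu⟩ := hp
    have hij : (i, j) ∉ pathCells (u ++ Sum.inr j :: Sum.inl i :: v) := by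
      intro h
      have r1 : Sum.inl i ∉ u := fun ha => lt_irrefl i (hu _ ha (Sum.inl i) (by simp))
      have r4 : Sum.inr j ∉ v := fun hb => lt_irrefl j (hj (Sum.inr j) hb)
      rw [mem_pathCells_append, mem_pathCells_inr, mem_pathCells_inl] at h
      rcases h with h | (h | h) | h
      · exact r1 (mem_of_mem_pathCells h).1
      · exact r4 h.2
      · exact r4 (mem_of_mem_pathCells h).2
      · exact r1 h.1
    have c0 : (pathCells (u ++ Sum.inr j :: Sum.inl i :: v)).card <
        (pathCells (u ++ Sum.inl i :: Sum.inr j :: v)).card := by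
      refine Finset.card_lt_card ⟨?_, fun h => hij (h ?_)⟩
      · rintro ⟨a, b⟩
        simp only [mem_pathCells_append, mem_pathCells_inl, mem_pathCells_inr, List.mem_cons]
        grind
      · simp [mem_pathCells_append, mem_pathCells_inl]
    have c1 : (pathCells (u ++ Sum.inr j :: v)).card ≤
        (pathCells (u ++ Sum.inl i :: Sum.inr j :: v)).card := by
      refine Finset.card_le_card ?_
      rintro ⟨a, b⟩
      simp only [mem_pathCells_append, mem_pathCells_inl, mem_pathCells_inr, List.mem_cons]
      grind
    have c2 : (pathCells (u ++ Sum.inl i :: v)).card ≤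
        (pathCells (u ++ Sum.inl i :: Sum.inr j :: v)).card := by
      refine Finset.card_le_card ?_
      rintro ⟨a, b⟩
      simp only [mem_pathCells_append, mem_pathCells_inl, mem_pathCells_inr, List.mem_cons]
      grind
    have c3 : (pathCells u).card ≤ (pathCells (u ++ Sum.inl i :: Sum.inr j :: v)).card := by
      refine Finset.card_le_card ?_
      rintro ⟨a, b⟩ h
      exact mem_pathCells_append.2 (Or.inl h)
    have c4 : (pathCells (Sum.inl i :: v)).card ≤
        (pathCells (u ++ Sum.inl i :: v)).card := by
      refine Finset.card_le_card ?_
      rintro ⟨a, b⟩ h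
      exact mem_pathCells_append.2 (Or.inr (Or.inl h))
    have p0 : (u ++ Sum.inr j :: Sum.inl i :: v).Pairwise StepRel := by
      rw [List.pairwise_append, List.pairwise_cons, List.pairwise_cons]
      refine ⟨pu, ⟨?_, ?_, pv⟩, ?_⟩
      · intro s hs
        rcases List.mem_cons.1 hs with rfl | hs
        · trivial
        · exact hj s hs
      · exact fun s hs => hi s (List.mem_cons_of_mem _ hs)
      · intro s hs t ht
        refine hu s hs t ?_
        simp only [List.mem_cons] at ht ⊢
        tauto
    rw [pathSum_corner x y hl, pathOp_corner, ih _ ?_ _ p0 rfl, ih _ ?_ _ (hsub _ s1) rfl,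
      ih _ ?_ _ (hsub _ s2) rfl, ih _ ?_ _ (hsub _ s3) rfl, ih _ ?_ _ (hsub _ s4) rfl]
    · simp only [Pi.add_apply, Pi.smul_apply, smul_eq_mul]
      ring
    all_goals
      simp only [List.length_append, List.length_cons]
      omega

end BorderPaths

/-! ### Canonical labels: Young diagrams with empty rows correspond to binary words. -/

section LabelledWords

/-- The border path with a given word (`true` for a south step), its rows numbered from `i` on and
its columns numbered from left to right. -/
def labelWord : ℕ → List Bool → List (ℕ ⊕ ℕ)
  | _, [] => []
  | i, true :: w => Sum.inl i :: labelWord (i + 1) w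
  | i, false :: w => Sum.inr (w.count false) :: labelWord i w

theorem inl_mem_labelWord {i a : ℕ} {w : List Bool} :
    Sum.inl a ∈ labelWord i w ↔ i ≤ a ∧ a < i + w.count true := by
  induction w generalizing i with
  | nil => simp [labelWord]
  | cons s w ih =>
    cases s
    · simp [labelWord, ih]
    · simp only [labelWord, List.mem_cons, Sum.inl.injEq, ih, List.count_cons_self]
      omega

theorem inr_mem_labelWord {i b : ℕ} {w : List Bool} :
    Sum.inr b ∈ labelWord i w ↔ b < w.count false := by
  induction w generalizing i with
  | nil => simp [labelWord]
  | cons s w ih =>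
    cases s
    · simp only [labelWord, List.mem_cons, Sum.inr.injEq, ih, List.count_cons_self]
      omega
    · simp [labelWord, ih]

theorem pairwise_labelWord (i : ℕ) (w : List Bool) : (labelWord i w).Pairwise StepRel := by
  induction w generalizing i with
  | nil => exact List.Pairwise.nil
  | cons s w ih =>
    cases s
    · refine List.pairwise_cons.2 ⟨?_, ih i⟩
      rintro (a | b) h
      · trivial
      · exact inr_mem_labelWord.1 h
    · refine List.pairwise_cons.2 ⟨?_, ih _⟩
      rintro (a | b) h
      · exact (inl_mem_labelWord.1 h).1
      · trivial

theorem pathRows_labelWord (w : List Bool) :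
    pathRows (labelWord 0 w) = Finset.range (w.count true) := by
  ext a
  simp [mem_pathRows, inl_mem_labelWord]

theorem pathCols_labelWord (i : ℕ) (w : List Bool) :
    pathCols (labelWord i w) = Finset.range (w.count false) := by
  ext a
  simp [mem_pathCols, inr_mem_labelWord]

theorem mem_pathCells_labelWord_true {i a b : ℕ} {w : List Bool} :
    (a, b) ∈ pathCells (labelWord i (true :: w)) ↔
      a = i ∧ b < w.count false ∨ (a, b) ∈ pathCells (labelWord (i + 1) w) := by
  rw [labelWord, mem_pathCells_inl, inr_mem_labelWord]

theorem mem_pathCells_labelWord_false {i a b : ℕ} {w : List Bool} :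
    (a, b) ∈ pathCells (labelWord i (false :: w)) ↔ (a, b) ∈ pathCells (labelWord i w) := by
  rw [labelWord, mem_pathCells_inr]

theorem bounds_of_mem_pathCells_labelWord {i a b : ℕ} {w : List Bool}
    (h : (a, b) ∈ pathCells (labelWord i w)) :
    (i ≤ a ∧ a < i + w.count true) ∧ b < w.count false := by
  have := mem_of_mem_pathCells h
  rwa [inl_mem_labelWord, inr_mem_labelWord] at this

theorem pathCells_labelWord_lower {i a b a' b' : ℕ} {w : List Bool}
    (h : (a, b) ∈ pathCells (labelWord i w)) (hi : i ≤ a') (ha : a' ≤ a) (hb : b' ≤ b) :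
    (a', b') ∈ pathCells (labelWord i w) := by
  induction w generalizing i with
  | nil => simp [labelWord, pathCells] at h
  | cons s w ih =>
    cases s
    · rw [mem_pathCells_labelWord_false] at h ⊢
      exact ih h hi
    · rw [mem_pathCells_labelWord_true] at h ⊢
      rcases h with ⟨rfl, h⟩ | h
      · exact Or.inl ⟨by omega, by omega⟩
      · have := bounds_of_mem_pathCells_labelWord h
        rcases hi.eq_or_lt with rfl | hlt
        · exact Or.inl ⟨rfl, by omega⟩
        · exact Or.inr (ih h hlt)

theorem labelWord_injective {i : ℕ} {w w' : List Bool} (ht : w.count true = w'.count true)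
    (hf : w.count false = w'.count false)
    (hc : pathCells (labelWord i w) = pathCells (labelWord i w')) : w = w' := by
  induction w generalizing i w' with
  | nil =>
    have := List.count_true_add_count_false w'
    rw [← ht, ← hf] at this
    exact (List.length_eq_zero_iff.1 (by simpa using this.symm)).symm
  | cons s w ih =>
    rcases w' with _ | ⟨s', w'⟩
    · have := List.count_true_add_count_false (s :: w)
      rw [ht, hf] at this
      simp at this
    have hmem : ∀ a b, (a, b) ∈ pathCells (labelWord i (s :: w)) ↔
        (a, b) ∈ pathCells (labelWord i (s' :: w')) := fun a b => by rw [hc]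
    cases s <;> cases s'
    · congr 1
      refine ih (i := i) (by simpa using ht) (by simpa using hf) ?_
      ext ⟨a, b⟩
      simpa only [mem_pathCells_labelWord_false] using hmem a b
    -- A leading south step gives row `i` a cell in the last column; after a leading west step that
    -- column has none.
    · have h1 := (hmem i (w'.count false - 1)).2
      rw [mem_pathCells_labelWord_true, mem_pathCells_labelWord_false] at h1
      simp at hf
      have := bounds_of_mem_pathCells_labelWord (h1 (Or.inl ⟨rfl, by omega⟩))
      omega
    · have h1 := (hmem i (w.count false - 1)).1
      rw [mem_pathCells_labelWord_true, mem_pathCells_labelWord_false] at h1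
      simp at hf
      have := bounds_of_mem_pathCells_labelWord (h1 (Or.inl ⟨rfl, by omega⟩))
      omega
    · congr 1
      refine ih (i := i + 1) (by simpa using ht) (by simpa using hf) ?_
      ext ⟨a, b⟩
      have h1 := hmem a b
      rw [mem_pathCells_labelWord_true, mem_pathCells_labelWord_true] at h1
      constructor
      · intro h
        have := bounds_of_mem_pathCells_labelWord h
        rcases h1.1 (Or.inr h) with h2 | h2
        · omega
        · exact h2
      · intro h
        have := bounds_of_mem_pathCells_labelWord h
        rcases h1.2 (Or.inr h) with h2 | h2
        · omega
        · exact h2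

theorem exists_labelWord_eq (r c i : ℕ) (μ : Finset (ℕ × ℕ))
    (hμ : ∀ a b, (a, b) ∈ μ → (i ≤ a ∧ a < i + r) ∧ b < c)
    (hl : ∀ a b a' b', (a, b) ∈ μ → i ≤ a' → a' ≤ a → b' ≤ b → (a', b') ∈ μ) :
    ∃ w : List Bool, w.count true = r ∧ w.count false = c ∧ pathCells (labelWord i w) = μ := by
  induction hN : r + c generalizing r c i μ with
  | zero =>
    obtain ⟨rfl, rfl⟩ : r = 0 ∧ c = 0 := by omega
    refine ⟨[], rfl, rfl, ?_⟩
    ext ⟨a, b⟩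
    simp only [labelWord, pathCells, Finset.notMem_empty, false_iff]
    intro h
    have := hμ a b h
    omega
  | succ N ih =>
    -- The path goes south exactly when there is a row left and row `i` meets all the `c` remaining
    -- columns.
    by_cases hD : r ≠ 0 ∧ (c = 0 ∨ (i, c - 1) ∈ μ)
    · obtain ⟨w, h1, h2, h3⟩ := ih (r - 1) c (i + 1) (μ.filter fun e => i < e.1)
        (by
          intro a b h
          rw [Finset.mem_filter] at h
          have := hμ a b h.1
          omega)
        (by
          intro a b a' b' h hi ha hb
          rw [Finset.mem_filter] at h ⊢
          exact ⟨hl a b a' b' h.1 (by omega) ha hb, hi⟩)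
        (by omega)
      refine ⟨true :: w, ?_, ?_, ?_⟩
      · rw [List.count_cons_self]
        omega
      · simpa using h2
      · ext ⟨a, b⟩
        rw [mem_pathCells_labelWord_true, h3, Finset.mem_filter, h2]
        constructor
        · rintro (⟨rfl, hb⟩ | h)
          · rcases hD.2 with hc | hc
            · omega
            · exact hl _ _ _ _ hc le_rfl le_rfl (by omega)
          · exact h.1
        · intro h
          have := hμ a b h
          rcases this.1.1.eq_or_lt with rfl | hlt
          · exact Or.inl ⟨rfl, this.2⟩
          · exact Or.inr ⟨h, hlt⟩
    · have hc : c ≠ 0 := by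
        rintro rfl
        exact hD ⟨by omega, Or.inl rfl⟩
      obtain ⟨w, h1, h2, h3⟩ := ih r (c - 1) i μ
        (by
          intro a b h
          have := hμ a b h
          refine ⟨this.1, ?_⟩
          by_contra hb
          refine hD ⟨by omega, Or.inr (hl a b i (c - 1) h le_rfl this.1.1 (by omega))⟩)
        hl (by omega)
      refine ⟨false :: w, ?_, ?_, ?_⟩
      · simpa using h1
      · rw [List.count_cons_self]
        omega
      · ext ⟨a, b⟩
        rw [mem_pathCells_labelWord_false, h3]

variable {A : Type*} [CommRing A] (x y : A)

/-- `pathOp` ignores the labels, so this is the noncommutative expansion of the power; `i` is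
general because a south step shifts the row numbers. -/
theorem pathOp_labelWord_ofFn_sum (n i : ℕ) :
    ∑ f : Fin n → Bool, pathOp x y (labelWord i (List.ofFn f)) =
      (southOp x + westOp x y) ^ n := by
  induction n generalizing i with
  | zero => simp [pathOp, labelWord]
  | succ n ih =>
    rw [← Equiv.sum_comp (Fin.consEquiv fun _ => Bool), Fintype.sum_prod_type, Fintype.sum_bool,
      pow_succ', add_mul]
    congr 1
    · rw [← ih (i + 1), Finset.mul_sum]
      refine Finset.sum_congr rfl fun f _ => ?_
      simp [Fin.consEquiv, labelWord, pathOp]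
    · rw [← ih i, Finset.mul_sum]
      refine Finset.sum_congr rfl fun f _ => ?_
      simp [Fin.consEquiv, labelWord, pathOp]

end LabelledWords

/-! ### Permutation tableaux as words with fillings, and the conclusion. -/

namespace PermutationTableau

/-- The permutation tableau with a given border word and filling. -/
def ofWord {n : ℕ} (w : List Bool) (hw : w.length = n) (S : Finset (ℕ × ℕ))
    (hS : IsFilling (pathCols (labelWord 0 w)) (pathCells (labelWord 0 w)) S) :
    PermutationTableau n :=
  let μ : YoungDiagram :=
    { cells := pathCells (labelWord 0 w)
      isLowerSet := fun ⟨_, _⟩ ⟨_, _⟩ hab h =>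
        pathCells_labelWord_lower h (Nat.zero_le _) hab.1 hab.2 }
  have hr : μ.rowLen 0 = w.count false := by
    refine le_antisymm ?_ ?_
    · by_contra! h
      rw [← YoungDiagram.mem_iff_lt_rowLen] at h
      exact lt_irrefl _ (bounds_of_mem_pathCells_labelWord h).2
    -- The last column contains a 1, hence a cell, so row 0 reaches it.
    · by_contra! h
      obtain ⟨i, hi⟩ := hS.2.1 (w.count false - 1) (by
        rw [pathCols_labelWord, Finset.mem_range]
        omega)
      have h0 : (0, w.count false - 1) ∈ μ :=
        pathCells_labelWord_lower (hS.1 hi) le_rfl (Nat.zero_le i) le_rfl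
      rw [YoungDiagram.mem_iff_lt_rowLen] at h0
      omega
  { shape := μ
    numRows := w.count true
    ones := S
    colLen_le := by
      by_contra! h
      rw [← YoungDiagram.mem_iff_lt_colLen] at h
      have := (bounds_of_mem_pathCells_labelWord h).1.2
      omega
    length_eq := by rw [hr, List.count_true_add_count_false, hw]
    ones_subset := hS.1
    exists_one := by
      intro j hj
      rw [hr] at hj
      obtain ⟨i, hi⟩ := hS.2.1 j (by rwa [pathCols_labelWord, Finset.mem_range])
      refine ⟨i, ?_, hi⟩
      have := (bounds_of_mem_pathCells_labelWord (hS.1 hi)).1.2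
      omega
    zero_cond := fun i j h h' hh => hS.2.2 i j h h' hh.1 hh.2 }

variable {n : ℕ} {A : Type*} [CommRing A] (x y : A)

theorem isFilling (T : PermutationTableau n) :
    IsFilling (Finset.range T.numCols) T.shape.cells T.ones := by
  refine ⟨T.ones_subset, fun j hj => ?_, fun i j h h' h1 h2 => T.zero_cond i j h h' ⟨h1, h2⟩⟩
  obtain ⟨i, -, hi⟩ := T.exists_one j (Finset.mem_range.1 hj)
  exact ⟨i, hi⟩

theorem fillingWeight_eq (T : PermutationTableau n) :
    fillingWeight x y (Finset.range T.numRows) (Finset.range T.numCols) T.shape.cells T.ones =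
      x ^ T.urr * y ^ T.urc := by
  classical
  rw [urr, urc, ← Finset.prod_const, ← Finset.prod_const, Finset.prod_filter,
    Finset.prod_filter, fillingWeight]
  congr 1
  · refine Finset.prod_congr rfl fun i _ => ?_
    congr 1
    simp only [IsUnrestrictedRow, IsRestrictedZero, eq_iff_iff]
    constructor
    · rintro h j - ⟨h1, h2, i', hi', h3⟩
      exact h j h1 h2 i' hi' h3
    · intro h j h1 h2 i' hi' h3
      exact h j (T.mem_box h1).2 ⟨h1, h2, i', hi', h3⟩
  · refine Finset.prod_congr rfl fun j _ => ?_
    congr 1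
    simp only [IsUnrestrictedCol, IsCRestrictedZero, eq_iff_iff]
    constructor
    · rintro h i - ⟨h1, h2, j', hj', h3⟩
      exact h i h1 h2 j' hj' h3
    · intro h i h1 h2 j' hj' h3
      exact h i (T.mem_box h1).1 ⟨h1, h2, j', hj', h3⟩

theorem numCols_ofWord (w : List Bool) (hw : w.length = n) (S : Finset (ℕ × ℕ))
    (hS : IsFilling (pathCols (labelWord 0 w)) (pathCells (labelWord 0 w)) S) :
    (ofWord w hw S hS).numCols = w.count false := by
  have h1 : w.count true + (ofWord w hw S hS).numCols = n := (ofWord w hw S hS).length_eq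
  have h2 := List.count_true_add_count_false w
  omega

theorem exists_ofWord_eq (T : PermutationTableau n) : ∃ (w : List Bool) (hw : w.length = n)
    (hS : IsFilling (pathCols (labelWord 0 w)) (pathCells (labelWord 0 w)) T.ones),
    ofWord w hw T.ones hS = T := by
  obtain ⟨w, h1, h2, h3⟩ := exists_labelWord_eq T.numRows T.numCols 0 T.shape.cells
    (fun a b h => by simpa using T.mem_box h)
    (fun a b a' b' h _ ha hb => T.shape.up_left_mem ha hb h)
  have hS := T.isFilling
  rw [← h3, ← h2, ← pathCols_labelWord 0] at hS
  refine ⟨w, ?_, hS, ?_⟩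
  · rw [← List.count_true_add_count_false, h1, h2]
    exact T.length_eq
  · exact PermutationTableau.ext (YoungDiagram.ext h3) h1 rfl

theorem sum_eq (n : ℕ) :
    ∑ T : PermutationTableau n, x ^ T.urr * y ^ T.urc =
      ∑ f : Fin n → Bool, pathSum x y (labelWord 0 (List.ofFn f)) := by
  classical
  simp only [pathSum, fillingSum]
  rw [Finset.sum_sigma']
  symm
  refine Finset.sum_bij (fun s hs => ofWord (List.ofFn s.1) List.length_ofFn s.2
    (mem_fillings.1 (Finset.mem_sigma.1 hs).2)) (fun _ _ => Finset.mem_univ _) ?_ ?_ ?_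
  · rintro ⟨f, S⟩ hs ⟨f', S'⟩ hs' h
    have h1 := congrArg numRows h
    have h2 := congrArg numCols h
    rw [numCols_ofWord, numCols_ofWord] at h2
    have h3 := congrArg (fun T : PermutationTableau n => T.shape.cells) h
    obtain rfl : S = S' := congrArg ones h
    obtain rfl : f = f' := List.ofFn_injective (labelWord_injective h1 h2 h3)
    rfl
  · intro T _
    obtain ⟨w, hw, hS, hT⟩ := T.exists_ofWord_eq
    subst hw
    refine ⟨⟨w.get, T.ones⟩, ?_, ?_⟩
    · rw [Finset.mem_sigma]
      refine ⟨Finset.mem_univ _, ?_⟩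
      simpa only [mem_fillings, List.ofFn_get] using hS
    · simp only [List.ofFn_get]
      exact hT
  · rintro ⟨f, S⟩ hs
    rw [← fillingWeight_eq, numCols_ofWord]
    simp only [pathRows_labelWord, pathCols_labelWord]
    rfl

end PermutationTableau

theorem sum_permutationTableau_eq_sum_perm {A : Type*} [CommRing A] (n : ℕ) (x y : A) :
    ∑ T : PermutationTableau n, x ^ T.urr * y ^ T.urc =
      ∑ π : Equiv.Perm (Fin n),
        x ^ PermStat.RLmin π * y ^ (PermStat.LRmax π - PermStat.pivot π) := by
  rw [PermutationTableau.sum_eq, sum_perm_eq, ← pathOp_labelWord_ofFn_sum x y n 0,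
    LinearMap.sum_apply, Finset.sum_apply]
  exact Finset.sum_congr rfl fun f _ => pathSum_eq x y _ (pairwise_labelWord 0 _)

theorem proposition4p4 {R : Type*} [CommSemiring R] (n : ℕ) (X Y : R) :
    ∑ T : PermutationTableau n, X ^ T.urr * Y ^ T.urc =
      ∑ π : Equiv.Perm (Fin n),
        X ^ PermStat.RLmin π * Y ^ (PermStat.LRmax π - PermStat.pivot π) := by
  have h : ∑ T : PermutationTableau n,
      (MvPolynomial.X 0 ^ T.urr * MvPolynomial.X 1 ^ T.urc : MvPolynomial (Fin 2) ℕ) =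
      ∑ π : Equiv.Perm (Fin n), MvPolynomial.X 0 ^ PermStat.RLmin π *
        MvPolynomial.X 1 ^ (PermStat.LRmax π - PermStat.pivot π) := by
    -- The corner recursion uses `y - 1`, so the identity is proved over `ℤ`, pulled back to
    -- polynomials over `ℕ`, and then evaluated in the semiring.
    apply MvPolynomial.map_injective (Nat.castRingHom ℤ) Nat.cast_injective
    simpa using sum_permutationTableau_eq_sum_perm n
      (MvPolynomial.X 0 : MvPolynomial (Fin 2) ℤ) (MvPolynomial.X 1)
  simpa using congrArg (MvPolynomial.eval₂ (Nat.castRingHom R) ![X, Y]) h
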